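/- Words are over the alphabet $\{0,1\}$. A Sturmian word is an infinite word having exactly $n+1$ distinct factors of length $n$ for every $n\in\mathbb N$; a morphism of $\{0,1\}^*$ is Sturmian if it maps every Sturmian word to a Sturmian word. A morphism $\psi$ is primitive if for some $k\ge 1$ every letter occurs in $\psi^k(x)$ for every letter $x$. Consider the elementary Sturmian morphisms $$\varphi_a:\ 0\mapsto 0,\ 1\mapsto 10;\qquad \varphi_b:\ 0\mapsto 0,\ 1\mapsto 01;\qquad \varphi_\alpha:\ 0\mapsto 01,\ 1\mapsto 1;\qquad \varphi_\beta:\ 0\mapsto 10,\ 1\mapsto 1,$$ and put $\varphi_w=\varphi_{w_0}\circ\cdots\circ\varphi_{w_{n-1}}$ for $w=w_0\cdots w_{n-1}\in\{a,b,\alpha,\beta\}^*$. The normalized name of $\psi=\varphi_w$ is the lexicographically greatest word (with $a<b$ and $\alpha<\beta$) that can be obtained from $w$ by applying, in either direction, the rewriting rules $\alpha a^k\beta=\beta b^k\alpha$ and $a\alpha^k b=b\beta^k a$, $k\in\mathbb N$. For a nonempty prefix $p$ of an infinite word $\mathbf u$, a return word to $p$ is a word $u_iu_{i+1}\cdots u_{j-1}$,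 where $i<j$ are two consecutive occurrences of $p$ in $\mathbf u$. If $r_0,\dots,r_{k-1}$ are the distinct return words to $p$ and $\mathbf u=r_{s_0}r_{s_1}r_{s_2}\cdots$, then $s_0s_1s_2\cdots$ is the derivated word of $\mathbf u$ with respect to $p$; derivated words that differ only by a permutation of letters are identified. The derivated words of $\mathbf u$ are those with respect to all its nonempty prefixes. Let $w\in\{a,\alpha\}^*$ be the normalized name of a primitive morphism $\psi$, and let $a$ be the first letter of $w$. Assume that $\psi$ is not a power of any other Sturmian morphism. Then: (i) $\psi$ has exactly one fixed point starting with $0$, and this fixed point has exactly $1+|w|_\alpha$ distinct derivated words; (ii) $\psi$ has exactly one fixed point starting with $1$, and this fixed point has exactly $1+|w|_a$ distinct derivated words. Here $|w|_x$ is the number of occurrences of the letter $x$ in $w$. -/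

import Mathlib

namespace Sturm

/-! Infinite words over `A` are functions `ℕ → A`, finite words over `A` are elements of
`FreeMonoid A`, morphisms of `A*` are elements of `Monoid.End (FreeMonoid A)` (the product of
this monoid is composition, and its powers are the iterates). -/

/-- The factor `u_i u_{i+1} ⋯ u_{i+n-1}` of an infinite word `u`. -/
def factor {A : Type*} (u : ℕ → A) (i n : ℕ) : FreeMonoid A :=
  FreeMonoid.ofList ((List.range n).map fun j => u (i + j))

/-- `v = ψ(u)`, that is, `v` is the concatenation `ψ(u₀) ψ(u₁) ψ(u₂) ⋯` (which has to be
infinite). -/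
def IsImage {A B : Type*} (ψ : FreeMonoid A →* FreeMonoid B) (u : ℕ → A) (v : ℕ → B) : Prop :=
  (∀ n, ψ (factor u 0 n) = factor v 0 (ψ (factor u 0 n)).length) ∧
    ∀ m, ∃ n, m ≤ (ψ (factor u 0 n)).length

/-- `u` is a fixed point of `ψ`. -/
def IsFixedPoint {A : Type*} (ψ : Monoid.End (FreeMonoid A)) (u : ℕ → A) : Prop :=
  IsImage ψ u u

/-- For some `k ≥ 1`, each letter occurs in the image by `ψ ^ k` of each letter. -/
def IsPrimitive {A : Type*} (ψ : Monoid.End (FreeMonoid A)) : Prop :=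
  ∃ k : ℕ, 0 < k ∧ ∀ x y : A, x ∈ ((ψ ^ k) (FreeMonoid.of y)).toList

/-- A Sturmian word: a binary infinite word with exactly `n + 1` factors of each length `n`. -/
def IsSturmian (u : ℕ → Fin 2) : Prop :=
  ∀ n : ℕ, (Set.range fun i => factor u i n).encard = n + 1

/-- A Sturmian morphism maps every Sturmian word to a Sturmian word. -/
def IsSturmianMorphism (ψ : Monoid.End (FreeMonoid (Fin 2))) : Prop :=
  ∀ u : ℕ → Fin 2, IsSturmian u → ∃ v : ℕ → Fin 2, IsImage ψ u v ∧ IsSturmian v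

/-! ### Return words and derivated words -/

/-- The index `i` is an occurrence of the finite word `p` in `u`. -/
def IsOccurrence {A : Type*} (u : ℕ → A) (p : FreeMonoid A) (i : ℕ) : Prop :=
  factor u i p.length = p

/-- The return words to `p` in `u`: the words `u_i ⋯ u_{j-1}` for consecutive occurrences
`i < j` of `p`. -/
def returnWords {A : Type*} (u : ℕ → A) (p : FreeMonoid A) : Set (FreeMonoid A) :=
  {r | ∃ i j : ℕ, i < j ∧ IsOccurrence u p i ∧ IsOccurrence u p j ∧
    (∀ k, i < k → k < j → ¬ IsOccurrence u p k) ∧ r = factor u i (j - i)}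

/-- `d` is a derivated word of `u` with respect to `p`: there are finitely many return words
to `p` in `u`, they are enumerated without repetition as `r 0, …, r (k - 1)`, the letters of `d`
are among `0, …, k - 1`, and `u` is the concatenation `r (d 0) r (d 1) r (d 2) ⋯`. -/
def IsDerivated {A : Type*} (u : ℕ → A) (p : FreeMonoid A) (d : ℕ → ℕ) : Prop :=
  ∃ (k : ℕ) (r : ℕ → FreeMonoid A), Set.BijOn r (Set.Iio k) (returnWords u p) ∧
    (∀ i, d i < k) ∧ IsImage (FreeMonoid.lift r) d u

/-- Infinite words over the alphabet `ℕ`, identified up to a permutation of letters. -/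
def letterSetoid : Setoid (ℕ → ℕ) where
  r d e := ∃ σ : Equiv.Perm ℕ, ∀ i, e i = σ (d i)
  iseqv :=
    { refl := fun _ => ⟨Equiv.refl ℕ, fun _ => rfl⟩
      symm := fun ⟨σ, h⟩ => ⟨σ.symm, fun i => by rw [h i, Equiv.symm_apply_apply]⟩
      trans := fun ⟨σ, h⟩ ⟨τ, h'⟩ => ⟨σ.trans τ, fun i => by rw [h' i, h i, Equiv.trans_apply]⟩ }

/-- The set of the derivated words of `u` with respect to its nonempty prefixes, where words that
differ by a permutation of letters are identified. -/
def Der {A : Type*} (u : ℕ → A) : Set (Quotient letterSetoid) :=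
  {c | ∃ (n : ℕ) (d : ℕ → ℕ), 0 < n ∧ IsDerivated u (factor u 0 n) d ∧
    c = Quotient.mk letterSetoid d}

/-! ### Elementary morphisms and normalized names -/

/-- The names of the four elementary Sturmian morphisms. -/
inductive Gen
  | a
  | b
  | α
  | β
  deriving DecidableEq

/-- The images of the letters by the elementary morphisms:
`a : 0 ↦ 0, 1 ↦ 10`, `b : 0 ↦ 0, 1 ↦ 01`, `α : 0 ↦ 01, 1 ↦ 1`, `β : 0 ↦ 10, 1 ↦ 1`. -/
def Gen.image : Gen → Fin 2 → List (Fin 2)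
  | .a => ![[0], [1, 0]]
  | .b => ![[0], [0, 1]]
  | .α => ![[0, 1], [1]]
  | .β => ![[1, 0], [1]]

/-- The elementary Sturmian morphisms. -/
def Gen.toEnd (g : Gen) : Monoid.End (FreeMonoid (Fin 2)) :=
  FreeMonoid.lift fun x => FreeMonoid.ofList (g.image x)

/-- `φ_w = φ_{w₀} ∘ φ_{w₁} ∘ ⋯ ∘ φ_{w_{n-1}}`. -/
def phi (w : List Gen) : Monoid.End (FreeMonoid (Fin 2)) :=
  (w.map Gen.toEnd).prod

/-- The relations `α a^k β = β b^k α` and `a α^k b = b β^k a`. -/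
inductive Rule : List Gen → List Gen → Prop
  | greek (k : ℕ) : Rule ([.α] ++ List.replicate k .a ++ [.β]) ([.β] ++ List.replicate k .b ++ [.α])
  | latin (k : ℕ) : Rule ([.a] ++ List.replicate k .α ++ [.b]) ([.b] ++ List.replicate k .β ++ [.a])

/-- One application of a relation inside a word, from left to right. -/
def Step (w v : List Gen) : Prop :=
  ∃ x y l r : List Gen, Rule l r ∧ w = x ++ l ++ y ∧ v = x ++ r ++ y

/-- `v` can be obtained from `w` by applications of the relations (in both directions). -/
def Rewrites : List Gen → List Gen → Prop :=
  Relation.EqvGen Step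

/-- The order of the names: `a < b` and `α < β`. -/
inductive Gen.Less : Gen → Gen → Prop
  | latin : Gen.Less .a .b
  | greek : Gen.Less .α .β

/-- `v` is `N(w)`, the lexicographically greatest word that can be obtained from `w` by
applications of the relations. -/
def IsNormalForm (w v : List Gen) : Prop :=
  Rewrites w v ∧ ∀ v', Rewrites w v' → v' = v ∨ List.Lex Gen.Less v' v

/-- `v` is the normalized name of `ψ`. -/
def IsNormalizedName (ψ : Monoid.End (FreeMonoid (Fin 2))) (v : List Gen) : Prop :=
  ∃ w : List Gen, ψ = phi w ∧ IsNormalForm w v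

end Sturm

open Sturm

/-!
The proof desubstitutes the fixed point letter by letter. For a letter `x` put
`lmor x : x ↦ x, z ↦ x z` and `rmor x : x ↦ x, z ↦ z x`; these are the four elementary morphisms,
and `of x * rmor x p = lmor x p * of x`, so `lmor x u = x · rmor x u` for infinite words `u`
(`isImage_lmor_iff`).

Two facts about prefixes carry the argument. The nonempty prefixes of `lmor x u` have the
same derivated words as all prefixes of `u`, the empty one included, whose derivated word is `u`
itself (`IsImage.exists_derivesTo_lmor`, `IsImage.exists_derivesTo_lmor'`). If `u` does not
begin with `x`, the nonempty prefixes of `rmor x u` have the same derivated words as the nonempty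
prefixes of `u` (`IsImage.exists_derivesTo_rmor`, `IsImage.exists_derivesTo_rmor'`).

A fixed point `u` of `φ_w`, where `w ∈ {a, α}*`, is the bottom of a tower `U 0 = u`,
`U i = rmor (c i) (U (i + 1))`, where `c` repeats the letters of `w` periodically and all the `U i`
begin with the same letter `z`. Let `y ≠ z`. Deleting the first letters, `s i = shift (U i)`, gives
`s i = lmor y (s (i + 1))` if `c i = y` and `s i = rmor z (s (i + 1))` if `c i = z`, and all
the `s i` begin with `y`. Hence the derivated words of `s i` are the `s (j + 1)` with `j ≥ i` and
`c j = y`. Moreover `U i = lmor z (s (i + 1))` if `c i = z`, so the first index `k` with `c k = z`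
contributes the additional derivated word `s (k + 1)` (`IsTower.der_eq`). Modulo the period this
makes one word for each `y` in the period and one more.

These words are pairwise different, even up to a permutation of letters: the letters
`c i, c (i + 1), …` can be read off from `s i`, so two equal words give a smaller period of `c`, and
then `φ_w` is a proper power of a morphism `φ_v` with `v ∈ {a, α}*`. Such a morphism is Sturmian, because
the elementary ones preserve the property of having exactly one right special factor of each length
(`isSturmian_iff`, `IsImage.isSturmian_rmor`).
-/

namespace Sturm

open FreeMonoid (of)

/-! ### Factors and images of infinite words -/

section Images

variable {A B C : Type*}

@[simp] theorem factor_zero (u : ℕ → A) (i : ℕ) : factor u i 0 = 1 := rfl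

@[simp] theorem length_factor (u : ℕ → A) (i n : ℕ) : (factor u i n).length = n := by
  simp [factor, FreeMonoid.length]

theorem factor_add (u : ℕ → A) (i m n : ℕ) :
    factor u i (m + n) = factor u i m * factor u (i + m) n := by
  simp [factor, List.range_add, Function.comp_def, add_assoc, FreeMonoid.ofList_append]

@[simp] theorem factor_one (u : ℕ → A) (i : ℕ) : factor u i 1 = of (u i) := by
  simp [factor, List.range_succ]

theorem factor_succ (u : ℕ → A) (i n : ℕ) :
    factor u i (n + 1) = factor u i n * of (u (i + n)) := by
  rw [factor_add, factor_one]

theorem factor_succ' (u : ℕ → A) (i n : ℕ) :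
    factor u i (n + 1) = of (u i) * factor u (i + 1) n := by
  rw [add_comm n 1, factor_add, factor_one]

theorem getElem_factor (u : ℕ → A) (i n k : ℕ) (h : k < (factor u i n).toList.length) :
    (factor u i n).toList[k] = u (i + k) := by
  simp [factor]

theorem factor_inj {u v : ℕ → A} {i j n : ℕ} :
    factor u i n = factor v j n ↔ ∀ k < n, u (i + k) = v (j + k) := by
  simp [factor]

theorem mul_inj_of_length {p q p' q' : FreeMonoid A} (hl : p.length = p'.length) :
    p * q = p' * q' ↔ p = p' ∧ q = q' :=
  ⟨fun h => List.append_inj h hl, fun h => by rw [h.1, h.2]⟩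

theorem exists_of_mul {p : FreeMonoid A} (hp : p ≠ 1) : ∃ x q, p = of x * q := by
  induction p using FreeMonoid.casesOn with
  | one => exact absurd rfl hp
  | of_mul x q => exact ⟨x, q, rfl⟩

/-- The length of `ψ(u₀ ⋯ u_{n-1})`: the place in `ψ(u)` where the image of `u_n` begins. -/
def pos (ψ : FreeMonoid A →* FreeMonoid B) (u : ℕ → A) (n : ℕ) : ℕ :=
  (ψ (factor u 0 n)).length

@[simp] theorem pos_zero (ψ : FreeMonoid A →* FreeMonoid B) (u : ℕ → A) : pos ψ u 0 = 0 := by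
  simp [pos]

theorem pos_add (ψ : FreeMonoid A →* FreeMonoid B) (u : ℕ → A) (m n : ℕ) :
    pos ψ u (m + n) = pos ψ u m + (ψ (factor u m n)).length := by
  simp [pos, factor_add]

theorem pos_succ (ψ : FreeMonoid A →* FreeMonoid B) (u : ℕ → A) (n : ℕ) :
    pos ψ u (n + 1) = pos ψ u n + (ψ (of (u n))).length := by
  rw [pos_add, factor_one]

theorem pos_mono (ψ : FreeMonoid A →* FreeMonoid B) (u : ℕ → A) : Monotone (pos ψ u) :=
  monotone_nat_of_le_succ fun n => by rw [pos_succ]; omega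

/-- A morphism is nonerasing if no letter has an empty image. -/
def Nonerasing (ψ : FreeMonoid A →* FreeMonoid B) : Prop :=
  ∀ x, 0 < (ψ (of x)).length

theorem Nonerasing.length_le {ψ : FreeMonoid A →* FreeMonoid B} (h : Nonerasing ψ)
    (p : FreeMonoid A) : p.length ≤ (ψ p).length := by
  induction p using FreeMonoid.inductionOn' with
  | one => simp
  | of_mul x p ih =>
    simp only [map_mul, FreeMonoid.length_mul, FreeMonoid.length_of]
    have := h x
    omega

theorem Nonerasing.comp {ψ : FreeMonoid B →* FreeMonoid C} {φ : FreeMonoid A →* FreeMonoid B}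
    (hψ : Nonerasing ψ) (hφ : Nonerasing φ) : Nonerasing (ψ.comp φ) :=
  fun x => (hφ x).trans_le (hψ.length_le _)

theorem Nonerasing.strictMono_pos {ψ : FreeMonoid A →* FreeMonoid B} (h : Nonerasing ψ)
    (u : ℕ → A) : StrictMono (pos ψ u) :=
  strictMono_nat_of_lt_succ fun n => by rw [pos_succ]; have := h (u n); omega

theorem Nonerasing.le_pos {ψ : FreeMonoid A →* FreeMonoid B} (h : Nonerasing ψ)
    (u : ℕ → A) (n : ℕ) : n ≤ pos ψ u n := by
  simpa [pos] using h.length_le (factor u 0 n)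

theorem IsImage.factor_pos {ψ : FreeMonoid A →* FreeMonoid B} {u : ℕ → A} {v : ℕ → B}
    (h : IsImage ψ u v) (i n : ℕ) :
    factor v (pos ψ u i) (ψ (factor u i n)).length = ψ (factor u i n) := by
  have h1 := h.1 (i + n)
  rw [factor_add, map_mul, FreeMonoid.length_mul, factor_add, mul_inj_of_length (by simp)] at h1
  simpa [pos] using h1.2.symm

/-- Blockwise description of images. -/
theorem isImage_iff {ψ : FreeMonoid A →* FreeMonoid B} (hψ : Nonerasing ψ) {u : ℕ → A}
    {v : ℕ → B} :
    IsImage ψ u v ↔ ∀ n, factor v (pos ψ u n) (ψ (of (u n))).length = ψ (of (u n)) := by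
  refine ⟨fun h n => by simpa using h.factor_pos n 1, fun h => ⟨fun n => ?_, fun m =>
    ⟨m, by simpa using hψ.length_le (factor u 0 m)⟩⟩⟩
  induction n with
  | zero => simp
  | succ n ih =>
    have := h n
    rw [factor_succ, map_mul, FreeMonoid.length_mul, factor_add, ← ih, zero_add, zero_add]
    rw [pos] at this
    rw [this]

theorem isImage_one (u : ℕ → A) : IsImage (MonoidHom.id (FreeMonoid A)) u u :=
  ⟨fun n => by simp, fun m => ⟨m, by simp⟩⟩

theorem IsImage.comp {ψ : FreeMonoid B →* FreeMonoid C} {φ : FreeMonoid A →* FreeMonoid B}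
    {u : ℕ → A} {v : ℕ → B} {t : ℕ → C} (hφ : IsImage φ u v) (hψ : IsImage ψ v t) :
    IsImage (ψ.comp φ) u t := by
  refine ⟨fun n => ?_, fun m => ?_⟩
  · rw [MonoidHom.comp_apply, hφ.1 n]
    simpa using hψ.1 _
  · obtain ⟨n, hn⟩ := hψ.2 m
    obtain ⟨k, hk⟩ := hφ.2 n
    refine ⟨k, hn.trans ?_⟩
    rw [MonoidHom.comp_apply, hφ.1 k]
    exact pos_mono ψ v hk

theorem pos_comp {ψ : FreeMonoid B →* FreeMonoid C} {φ : FreeMonoid A →* FreeMonoid B}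
    {u : ℕ → A} {v : ℕ → B} (hφ : IsImage φ u v) (n : ℕ) :
    pos (ψ.comp φ) u n = pos ψ v (pos φ u n) := by
  rw [pos, MonoidHom.comp_apply, hφ.1 n]
  rfl

theorem IsImage.unique {ψ : FreeMonoid A →* FreeMonoid B} {u : ℕ → A} {v v' : ℕ → B}
    (h : IsImage ψ u v) (h' : IsImage ψ u v') : v = v' := by
  funext m
  obtain ⟨n, hn⟩ := h.2 (m + 1)
  have := factor_inj.1 ((h.1 n).symm.trans (h'.1 n)) m (by omega)
  simpa using this

/-- Every place in `ψ(u)` lies in the image of some letter of `u`. -/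
theorem Nonerasing.exists_pos_le {ψ : FreeMonoid A →* FreeMonoid B} (hψ : Nonerasing ψ)
    (u : ℕ → A) (m : ℕ) : ∃ n, pos ψ u n ≤ m ∧ m < pos ψ u (n + 1) := by
  induction m with
  | zero => exact ⟨0, by simp, by rw [pos_succ]; have := hψ (u 0); simpa using this⟩
  | succ m ih =>
    obtain ⟨n, h1, h2⟩ := ih
    by_cases h : m + 1 < pos ψ u (n + 1)
    · exact ⟨n, by omega, h⟩
    · exact ⟨n + 1, by omega, by have := hψ.strictMono_pos u (Nat.lt_add_one (n + 1)); omega⟩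

theorem Nonerasing.exists_isImage {ψ : FreeMonoid A →* FreeMonoid B} (hψ : Nonerasing ψ)
    (u : ℕ → A) : ∃ v, IsImage ψ u v := by
  have hlt : ∀ m, m < (ψ (factor u 0 (m + 1))).toList.length := fun m => by
    have := hψ.length_le (factor u 0 (m + 1))
    rw [length_factor] at this
    exact this
  -- the letters of `ψ(u₀ ⋯ u_{n-1})` do not depend on `n`
  have hget : ∀ n k x, (ψ (factor u 0 n)).toList[x]? = none ∨
      (ψ (factor u 0 n)).toList[x]? = (ψ (factor u 0 (n + k))).toList[x]? := fun n k x => by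
    rw [factor_add, map_mul, FreeMonoid.toList_mul]
    by_cases hx : x < (ψ (factor u 0 n)).toList.length
    · right; rw [List.getElem?_append_left hx]
    · left; exact List.getElem?_eq_none (not_lt.1 hx)
  refine ⟨fun m => (ψ (factor u 0 (m + 1))).toList[m]'(hlt m), fun n => ?_, fun m =>
    ⟨m, by simpa using hψ.length_le (factor u 0 m)⟩⟩
  apply FreeMonoid.toList.injective
  apply List.ext_getElem
  · simp [factor, FreeMonoid.length]
  · intro i h1 h2
    rw [getElem_factor]
    simp only [zero_add]
    rw [← Option.some_inj, ← List.getElem?_eq_getElem, ← List.getElem?_eq_getElem]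
    have e1 : (ψ (factor u 0 n)).toList[i]? ≠ none := by
      rw [List.getElem?_eq_getElem h1]; simp
    have e2 : (ψ (factor u 0 (i + 1))).toList[i]? ≠ none := by
      rw [List.getElem?_eq_getElem (hlt i)]; simp
    have := (hget n (i + 1) i).resolve_left e1
    rw [this, (hget (i + 1) n i).resolve_left e2, add_comm n]

theorem IsImage.of_comp {ψ : FreeMonoid B →* FreeMonoid C} {φ : FreeMonoid A →* FreeMonoid B}
    {u : ℕ → A} {v : ℕ → B} {t : ℕ → C} (hn : Nonerasing ψ) (h : IsImage (ψ.comp φ) u t)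
    (hφ : IsImage φ u v) : IsImage ψ v t := by
  obtain ⟨t', ht'⟩ := hn.exists_isImage v
  rwa [h.unique (hφ.comp ht')]

theorem IsImage.drop {ψ : FreeMonoid A →* FreeMonoid B} {u : ℕ → A} {v : ℕ → B}
    (hψ : Nonerasing ψ) (h : IsImage ψ u v) (i : ℕ) :
    IsImage ψ (fun n => u (i + n)) (fun n => v (pos ψ u i + n)) := by
  refine ⟨fun n => ?_, fun m => ⟨m, ?_⟩⟩
  · have h1 : factor (fun n => u (i + n)) 0 n = factor u i n := factor_inj.2 fun k _ => by simp
    rw [h1, ← h.factor_pos i n, length_factor]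
    exact factor_inj.2 fun k _ => by simp
  · simpa using hψ.length_le (factor (fun n => u (i + n)) 0 m)

/-- The infinite word obtained by deleting the first letter. -/
def shift (u : ℕ → A) : ℕ → A := fun n => u (n + 1)

theorem factor_shift (u : ℕ → A) (i n : ℕ) : factor (shift u) i n = factor u (i + 1) n :=
  factor_inj.2 fun k _ => by simp only [shift]; congr 1; omega

end Images

/-! ### The elementary morphisms -/

section Elementary

variable {A B : Type*}

/-- The morphism `x ↦ x`, `z ↦ x z` for the letters `z ≠ x`; for `x = 0` and `x = 1` it is
`φ_b` and `φ_β`. -/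
def lmor (x : Fin 2) : FreeMonoid (Fin 2) →* FreeMonoid (Fin 2) :=
  FreeMonoid.lift fun z => if z = x then of x else of x * of z

/-- The morphism `x ↦ x`, `z ↦ z x` for the letters `z ≠ x`; for `x = 0` and `x = 1` it is
`φ_a` and `φ_α`. -/
def rmor (x : Fin 2) : FreeMonoid (Fin 2) →* FreeMonoid (Fin 2) :=
  FreeMonoid.lift fun z => if z = x then of x else of z * of x

/-- The elementary morphism of a given name, seen as a plain homomorphism. -/
def Gen.hom (g : Gen) : FreeMonoid (Fin 2) →* FreeMonoid (Fin 2) := g.toEnd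

/-- The morphism `φ_w`, seen as a plain homomorphism. -/
def phiHom (w : List Gen) : FreeMonoid (Fin 2) →* FreeMonoid (Fin 2) := phi w

/-- The name of `lmor x`. -/
def lgen (x : Fin 2) : Gen := if x = 0 then .b else .β

/-- The name of `rmor x`. -/
def rgen (x : Fin 2) : Gen := if x = 0 then .a else .α

theorem hom_lgen (x : Fin 2) : (lgen x).hom = lmor x := by
  apply FreeMonoid.hom_eq
  intro z
  fin_cases x <;> fin_cases z <;> rfl

theorem hom_rgen (x : Fin 2) : (rgen x).hom = rmor x := by
  apply FreeMonoid.hom_eq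
  intro z
  fin_cases x <;> fin_cases z <;> rfl

@[simp] theorem lmor_self (x : Fin 2) : lmor x (of x) = of x := by
  rw [lmor, FreeMonoid.lift_eval_of, if_pos rfl]

theorem lmor_ne {x z : Fin 2} (h : z ≠ x) : lmor x (of z) = of x * of z := by
  rw [lmor, FreeMonoid.lift_eval_of, if_neg h]

@[simp] theorem rmor_self (x : Fin 2) : rmor x (of x) = of x := by
  rw [rmor, FreeMonoid.lift_eval_of, if_pos rfl]

theorem rmor_ne {x z : Fin 2} (h : z ≠ x) : rmor x (of z) = of z * of x := by
  rw [rmor, FreeMonoid.lift_eval_of, if_neg h]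

theorem nonerasing_lmor (x : Fin 2) : Nonerasing (lmor x) := fun z => by
  by_cases h : z = x
  · simp [h]
  · simp [lmor_ne h]

theorem nonerasing_rmor (x : Fin 2) : Nonerasing (rmor x) := fun z => by
  by_cases h : z = x
  · simp [h]
  · simp [rmor_ne h]

/-- The two morphisms are conjugate by the letter `x`. -/
theorem of_mul_rmor (x : Fin 2) (p : FreeMonoid (Fin 2)) :
    of x * rmor x p = lmor x p * of x := by
  induction p using FreeMonoid.inductionOn' with
  | one => simp
  | of_mul z p ih =>
    rw [map_mul, map_mul, mul_assoc, ← ih]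
    by_cases h : z = x
    · simp [h]
    · simp [rmor_ne h, lmor_ne h, mul_assoc]

theorem exists_rmor_of (x z : Fin 2) : ∃ t, rmor x (of z) = of z * t := by
  by_cases h : z = x
  · exact ⟨1, by simp [h]⟩
  · exact ⟨of x, rmor_ne h⟩

/-- The code `rmor x` can be decoded from the left, without any delay. -/
theorem rmor_prefix {x : Fin 2} {p q s : FreeMonoid (Fin 2)} (h : rmor x q = rmor x p * s) :
    ∃ t, q = p * t := by
  induction p using FreeMonoid.inductionOn' generalizing q with
  | one => exact ⟨q, by simp⟩
  | of_mul z p ih =>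
    induction q using FreeMonoid.casesOn with
    | one =>
      have := congrArg FreeMonoid.length h
      have := nonerasing_rmor x z
      simp at *
      omega
    | of_mul z' q =>
      obtain ⟨t, ht⟩ := exists_rmor_of x z
      obtain ⟨t', ht'⟩ := exists_rmor_of x z'
      have hz : z' = z := by
        have h' := h
        rw [map_mul, map_mul, ht, ht', mul_assoc, mul_assoc, mul_assoc,
          mul_inj_of_length (by simp)] at h'
        exact FreeMonoid.of_injective h'.1
      subst hz
      rw [map_mul, map_mul, mul_assoc, mul_inj_of_length rfl] at h
      obtain ⟨r, hr⟩ := ih h.2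
      exact ⟨r, by rw [hr, mul_assoc]⟩

section Images

variable {x : Fin 2} {u v : ℕ → Fin 2}

/-- For infinite words, `lmor x u = x · rmor x u`. -/
theorem isImage_lmor_iff : IsImage (lmor x) u v ↔ v 0 = x ∧ IsImage (rmor x) u (shift v) := by
  have key : ∀ v : ℕ → Fin 2, v 0 = x → IsImage (rmor x) u (shift v) → IsImage (lmor x) u v := by
    intro v h0 h
    refine ⟨fun n => ?_, fun m => ⟨m, ?_⟩⟩
    · have h1 := h.1 n
      have h2 := of_mul_rmor x (factor u 0 n)
      have h3 : (rmor x (factor u 0 n)).length = (lmor x (factor u 0 n)).length := by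
        simpa [add_comm] using congrArg FreeMonoid.length h2
      obtain rfl := h0
      rw [h1, factor_shift, ← factor_succ', h3, factor_succ, mul_inj_of_length (by simp)] at h2
      exact h2.1.symm
    · simpa using (nonerasing_lmor x).length_le (factor u 0 m)
  refine ⟨fun h => ?_, fun h => key v h.1 h.2⟩
  obtain ⟨t, ht⟩ := (nonerasing_rmor x).exists_isImage u
  have h1 := h.unique (key (fun n => Nat.casesOn (motive := fun _ => Fin 2) n x t) rfl ht)
  subst h1
  exact ⟨rfl, ht⟩

theorem IsImage.rmor_pos (h : IsImage (rmor x) u v) (n : ℕ) : v (pos (rmor x) u n) = u n := by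
  have h1 := h.factor_pos n 1
  obtain ⟨t, ht⟩ := exists_rmor_of x (u n)
  rw [factor_one, ht, FreeMonoid.length_mul, FreeMonoid.length_of, add_comm, factor_succ',
    mul_inj_of_length (by simp)] at h1
  exact FreeMonoid.of_injective h1.1

theorem pos_rmor_self {n : ℕ} (hn : u n = x) : pos (rmor x) u (n + 1) = pos (rmor x) u n + 1 := by
  rw [pos_succ, hn]
  simp

theorem pos_rmor_ne {n : ℕ} (hn : u n ≠ x) : pos (rmor x) u (n + 1) = pos (rmor x) u n + 2 := by
  rw [pos_succ, rmor_ne hn]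
  simp

theorem IsImage.rmor_pos_add_one (h : IsImage (rmor x) u v) {n : ℕ} (hn : u n ≠ x) :
    v (pos (rmor x) u n + 1) = x := by
  have h1 := h.factor_pos n 1
  rw [factor_one, rmor_ne hn, FreeMonoid.length_mul, FreeMonoid.length_of, factor_add,
    mul_inj_of_length (by simp)] at h1
  exact FreeMonoid.of_injective (by simpa using h1.2)

/-- In `rmor x u`, each letter different from `x` begins a block. -/
theorem IsImage.rmor_ne (h : IsImage (rmor x) u v) {m : ℕ} (hm : v m ≠ x) :
    ∃ n, m = pos (rmor x) u n ∧ u n = v m := by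
  obtain ⟨n, h1, h2⟩ := (nonerasing_rmor x).exists_pos_le u m
  rcases h1.eq_or_lt with h1 | h1
  · exact ⟨n, h1.symm, by rw [← h1, h.rmor_pos]⟩
  · exfalso
    by_cases hn : u n = x
    · rw [pos_rmor_self hn] at h2; omega
    · rw [pos_rmor_ne hn] at h2
      have : m = pos (rmor x) u n + 1 := by omega
      exact hm (this ▸ h.rmor_pos_add_one hn)

/-- In `rmor x u`, each letter `x` ends a block. -/
theorem IsImage.rmor_eq (h : IsImage (rmor x) u v) {m : ℕ} (hm : v m = x) :
    ∃ n, m + 1 = pos (rmor x) u (n + 1) := by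
  obtain ⟨n, h1, h2⟩ := (nonerasing_rmor x).exists_pos_le u m
  refine ⟨n, ?_⟩
  by_cases hn : u n = x
  · rw [pos_rmor_self hn] at h2 ⊢; omega
  · rw [pos_rmor_ne hn] at h2 ⊢
    rcases h1.eq_or_lt with h1 | h1
    · rw [← h1, h.rmor_pos] at hm
      exact absurd hm hn
    · omega

theorem pos_lmor_eq (x : Fin 2) (u : ℕ → Fin 2) (n : ℕ) : pos (lmor x) u n = pos (rmor x) u n := by
  simpa [pos, add_comm] using (congrArg FreeMonoid.length (of_mul_rmor x (factor u 0 n))).symm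

/-- In `lmor x u`, the letters `x` are the beginnings of the blocks. -/
theorem IsImage.lmor_eq_iff (h : IsImage (lmor x) u v) {m : ℕ} :
    v m = x ↔ ∃ n, m = pos (rmor x) u n := by
  rw [isImage_lmor_iff] at h
  obtain ⟨h0, h⟩ := h
  cases m with
  | zero => simpa [h0] using ⟨0, by simp⟩
  | succ m =>
    refine ⟨fun hm => ?_, ?_⟩
    · obtain ⟨n, hn⟩ := h.rmor_eq (m := m) hm
      exact ⟨n + 1, hn⟩
    · rintro ⟨n, hn⟩
      cases n with
      | zero => simp at hn
      | succ n =>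
        change shift v m = x
        by_cases hx : u n = x
        · rw [pos_rmor_self hx] at hn
          rw [show m = pos (rmor x) u n by omega, h.rmor_pos, hx]
        · rw [pos_rmor_ne hx] at hn
          rw [show m = pos (rmor x) u n + 1 by omega, h.rmor_pos_add_one hx]

theorem IsImage.lmor_ne (h : IsImage (lmor x) u v) {m : ℕ} (hm : v m ≠ x) :
    ∃ n, m = pos (rmor x) u n + 1 ∧ u n = v m := by
  rw [isImage_lmor_iff] at h
  cases m with
  | zero => exact absurd h.1 hm
  | succ m =>
    obtain ⟨n, h1, h2⟩ := h.2.rmor_ne (m := m) hm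
    exact ⟨n, by omega, h2⟩

theorem IsImage.shift_self (h : IsImage (rmor x) u v) (hu : u 0 = x) :
    IsImage (rmor x) (shift u) (shift v) := by
  have := h.drop (nonerasing_rmor x) 1
  rw [pos_rmor_self hu, pos_zero] at this
  convert this using 1
  · ext n; simp [shift, add_comm]
  · ext n; simp [shift, add_comm]

/-- If `u` begins with `x`, then `rmor x u = lmor x (shift u)`. -/
theorem IsImage.lmor_shift (h : IsImage (rmor x) u v) (hu : u 0 = x) :
    IsImage (lmor x) (shift u) v :=
  isImage_lmor_iff.2 ⟨by simpa [hu] using h.rmor_pos 0, h.shift_self hu⟩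

/-- If `u` does not begin with `x`, then deleting the first letter turns `rmor x` into `lmor x`. -/
theorem IsImage.shift_ne (h : IsImage (rmor x) u v) (hu : u 0 ≠ x) :
    IsImage (lmor x) (shift u) (shift v) := by
  refine isImage_lmor_iff.2 ⟨by simpa [shift] using h.rmor_pos_add_one hu, ?_⟩
  have := h.drop (nonerasing_rmor x) 1
  rw [pos_rmor_ne hu, pos_zero] at this
  convert this using 1
  · ext n; simp [shift, add_comm]
  · ext n; simp only [shift]; congr 2; omega

end Images

/-- Different infinite words have different images by `ψ`. -/
def InjOnWords (ψ : FreeMonoid A →* FreeMonoid B) : Prop :=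
  ∀ u u' v, IsImage ψ u v → IsImage ψ u' v → u = u'

/-- The images of two infinite words under `rmor x` agree on `rmor x (u₀ ⋯ u_{n-1})` exactly if the
words agree on the first `n` letters. -/
theorem factor_rmor_iff {x : Fin 2} {u u' t t' : ℕ → Fin 2} (h : IsImage (rmor x) u t)
    (h' : IsImage (rmor x) u' t') (n : ℕ) :
    factor t' 0 (pos (rmor x) u n) = factor t 0 (pos (rmor x) u n) ↔
      factor u' 0 n = factor u 0 n := by
  refine ⟨fun he => ?_, fun he => ?_⟩
  · obtain ⟨N, hN⟩ := h'.2 (pos (rmor x) u n)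
    obtain ⟨k, hk⟩ := Nat.exists_eq_add_of_le hN
    have h1 := h'.1 N
    rw [hk, factor_add, he, pos, ← h.1] at h1
    obtain ⟨t, ht⟩ := rmor_prefix h1
    have hl : n ≤ N := by
      have := congrArg FreeMonoid.length ht
      simp at this; omega
    obtain ⟨j, rfl⟩ := Nat.exists_eq_add_of_le hl
    rw [factor_add, mul_inj_of_length (by simp)] at ht
    exact ht.1
  · have h1 := h'.1 n
    rw [he, h.1 n] at h1
    simpa [pos] using h1.symm

theorem injOnWords_rmor (x : Fin 2) : InjOnWords (rmor x) := by
  intro u u' v h h'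
  funext n
  have := factor_inj.1 ((factor_rmor_iff h h' (n + 1)).1 rfl) n (by omega)
  simpa using this.symm

theorem injOnWords_lmor (x : Fin 2) : InjOnWords (lmor x) := fun u u' _ h h' =>
  injOnWords_rmor x u u' _ (isImage_lmor_iff.1 h).2 (isImage_lmor_iff.1 h').2

theorem Gen.cases_lr (g : Gen) : ∃ x, g = lgen x ∨ g = rgen x := by
  cases g
  · exact ⟨0, .inr rfl⟩
  · exact ⟨0, .inl rfl⟩
  · exact ⟨1, .inr rfl⟩
  · exact ⟨1, .inl rfl⟩

theorem nonerasing_hom (g : Gen) : Nonerasing g.hom := by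
  obtain ⟨x, rfl | rfl⟩ := g.cases_lr
  · rw [hom_lgen]; exact nonerasing_lmor x
  · rw [hom_rgen]; exact nonerasing_rmor x

theorem injOnWords_hom (g : Gen) : InjOnWords g.hom := by
  obtain ⟨x, rfl | rfl⟩ := g.cases_lr
  · rw [hom_lgen]; exact injOnWords_lmor x
  · rw [hom_rgen]; exact injOnWords_rmor x

@[simp] theorem phiHom_nil : phiHom [] = MonoidHom.id _ := rfl

theorem phiHom_cons (g : Gen) (w : List Gen) : phiHom (g :: w) = g.hom.comp (phiHom w) := by
  change phi (g :: w) = g.toEnd * phi w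
  simp [phi]

theorem nonerasing_phiHom (w : List Gen) : Nonerasing (phiHom w) := by
  induction w with
  | nil => intro x; simp
  | cons g w ih => rw [phiHom_cons]; exact (nonerasing_hom g).comp ih

theorem injOnWords_phiHom (w : List Gen) : InjOnWords (phiHom w) := by
  induction w with
  | nil =>
    intro u u' v h h'
    exact ((isImage_one u).unique h).trans (h'.unique (isImage_one u'))
  | cons g w ih =>
    intro u u' v h h'
    rw [phiHom_cons] at h h'
    obtain ⟨t, ht⟩ := (nonerasing_phiHom w).exists_isImage u
    obtain ⟨t', ht'⟩ := (nonerasing_phiHom w).exists_isImage u'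
    have h1 := h.of_comp (nonerasing_hom g) ht
    have h2 := h'.of_comp (nonerasing_hom g) ht'
    obtain rfl := injOnWords_hom g _ _ _ h1 h2
    exact ih _ _ _ ht ht'

end Elementary

/-! ### Occurrences of prefixes in images -/

section Occurrences

theorem isOccurrence_iff {A : Type*} {u : ℕ → A} {n m : ℕ} :
    IsOccurrence u (factor u 0 n) m ↔ factor u m n = factor u 0 n := by
  rw [IsOccurrence, length_factor]

theorem factor_drop {A : Type*} (u : ℕ → A) (m n : ℕ) :
    factor (fun i => u (m + i)) 0 n = factor u m n :=
  factor_inj.2 fun k _ => by simp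

/-- If the last letter of a prefix determines the next letter, then the prefix and its extension
by one letter have the same occurrences. -/
theorem isOccurrence_succ {A : Type*} {u : ℕ → A} {n : ℕ}
    (h : ∀ m, u m = u n → u (m + 1) = u (n + 1)) (m : ℕ) :
    IsOccurrence u (factor u 0 (n + 1)) m ↔ IsOccurrence u (factor u 0 (n + 2)) m := by
  rw [isOccurrence_iff, isOccurrence_iff, factor_inj, factor_inj]
  refine ⟨fun hk k hkn => ?_, fun hk k hkn => hk k (by omega)⟩
  rcases Nat.lt_succ_iff_lt_or_eq.1 hkn with h1 | rfl
  · exact hk k h1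
  · have := h (m + n) (by simpa using hk n (by omega))
    simpa [add_assoc] using this

variable {x : Fin 2} {u v : ℕ → Fin 2}

theorem IsImage.isOccurrence_lmor (h : IsImage (lmor x) u v) (n m : ℕ) :
    IsOccurrence v (factor v 0 (pos (rmor x) u n + 1)) m ↔
      ∃ l, m = pos (lmor x) u l ∧ IsOccurrence u (factor u 0 n) l := by
  have key : ∀ l, IsOccurrence v (factor v 0 (pos (rmor x) u n + 1)) (pos (lmor x) u l) ↔
      IsOccurrence u (factor u 0 n) l := by
    intro l
    have h1 := isImage_lmor_iff.1 h
    have h2 := isImage_lmor_iff.1 (h.drop (nonerasing_lmor x) l)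
    rw [isOccurrence_iff, isOccurrence_iff, ← factor_drop, ← factor_drop u l,
      ← factor_rmor_iff h1.2 h2.2 n, factor_succ', factor_succ',
      mul_inj_of_length (by simp), factor_shift, factor_shift, h1.1, h2.1]
    simp
  constructor
  · intro hm
    have hx : v m = x := by
      rw [isOccurrence_iff, factor_inj] at hm
      have := hm 0 (by omega)
      rw [← (isImage_lmor_iff.1 h).1]
      simpa using this
    obtain ⟨l, rfl⟩ := h.lmor_eq_iff.1 hx
    rw [← pos_lmor_eq] at hm ⊢
    exact ⟨l, rfl, (key l).1 (by simpa [pos_lmor_eq] using hm)⟩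
  · rintro ⟨l, rfl, hl⟩
    exact (key l).2 hl

theorem IsImage.isOccurrence_rmor (h : IsImage (rmor x) u v) (hu : u 0 ≠ x) {n : ℕ} (hn : 0 < n)
    (m : ℕ) : IsOccurrence v (factor v 0 (pos (rmor x) u n)) m ↔
      ∃ l, m = pos (rmor x) u l ∧ IsOccurrence u (factor u 0 n) l := by
  have key : ∀ l, IsOccurrence v (factor v 0 (pos (rmor x) u n)) (pos (rmor x) u l) ↔
      IsOccurrence u (factor u 0 n) l := by
    intro l
    rw [isOccurrence_iff, isOccurrence_iff, ← factor_drop, ← factor_drop u l,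
      ← factor_rmor_iff h (h.drop (nonerasing_rmor x) l) n]
  constructor
  · intro hm
    have hx : v m ≠ x := by
      rw [isOccurrence_iff, factor_inj] at hm
      have h1 := hm 0 (hn.trans_le ((nonerasing_rmor x).le_pos u n))
      have h2 := h.rmor_pos 0
      simp only [add_zero, pos_zero] at h1 h2
      rwa [h1, h2]
    obtain ⟨l, rfl, -⟩ := h.rmor_ne hx
    exact ⟨l, rfl, (key l).1 hm⟩
  · rintro ⟨l, rfl, hl⟩
    exact (key l).2 hl

theorem IsImage.rmor_next (h : IsImage (rmor x) u v) {m : ℕ} (hm : v m ≠ x) : v (m + 1) = x := by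
  obtain ⟨l, rfl, hl⟩ := h.rmor_ne hm
  exact h.rmor_pos_add_one (hl ▸ hm)

theorem IsImage.lmor_next (h : IsImage (lmor x) u v) {m : ℕ} (hm : v m ≠ x) : v (m + 1) = x := by
  obtain ⟨l, rfl, hl⟩ := h.lmor_ne hm
  exact h.lmor_eq_iff.2 ⟨l + 1, by rw [pos_rmor_ne (hl ▸ hm)]⟩

/-- The prefix of `u` of length `n` has the infinite word `z` as its derivated word, by way of a
composition of elementary morphisms: this morphism maps `z` to `u`, and the occurrences of the
prefix are the places where the images of the letters of `z` begin. -/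
def DerivesTo (u : ℕ → Fin 2) (n : ℕ) (z : ℕ → Fin 2) : Prop :=
  ∃ w : List Gen, IsImage (phiHom w) z u ∧
    ∀ m, IsOccurrence u (factor u 0 n) m ↔ ∃ l, m = pos (phiHom w) z l

theorem derivesTo_zero (u : ℕ → Fin 2) : DerivesTo u 0 u :=
  ⟨[], isImage_one u, fun m => ⟨fun _ => ⟨m, by simp [pos]⟩, fun _ => rfl⟩⟩

theorem DerivesTo.image {g : Gen} {n n' : ℕ} {z : ℕ → Fin 2} (h : IsImage g.hom u v)
    (hocc : ∀ m, IsOccurrence v (factor v 0 n) m ↔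
      ∃ l, m = pos g.hom u l ∧ IsOccurrence u (factor u 0 n') l) (hz : DerivesTo u n' z) :
    DerivesTo v n z := by
  obtain ⟨w, hw, hl⟩ := hz
  refine ⟨g :: w, by rw [phiHom_cons]; exact hw.comp h, fun m => ?_⟩
  rw [hocc, phiHom_cons]
  constructor
  · rintro ⟨l, rfl, h'⟩
    obtain ⟨k, rfl⟩ := (hl l).1 h'
    exact ⟨k, by rw [pos_comp hw]⟩
  · rintro ⟨k, rfl⟩
    exact ⟨_, pos_comp hw k, (hl _).2 ⟨k, rfl⟩⟩

/-- Each nonempty prefix of `lmor x u` has the derivated word of a shorter prefix of `u`. -/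
theorem IsImage.exists_derivesTo_lmor (h : IsImage (lmor x) u v) {n : ℕ} (hn : 0 < n) :
    ∃ n' < n, ∀ z, DerivesTo u n' z → DerivesTo v n z := by
  have hg : IsImage (lgen x).hom u v := by rwa [hom_lgen]
  obtain ⟨k, rfl⟩ := Nat.exists_eq_add_of_lt hn
  rw [zero_add] at *
  by_cases hk : v k = x
  · obtain ⟨l, rfl⟩ := h.lmor_eq_iff.1 hk
    refine ⟨l, Nat.lt_succ_of_le ((nonerasing_rmor x).le_pos u l), fun z hz => hz.image hg ?_⟩
    intro m
    rw [hom_lgen]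
    exact h.isOccurrence_lmor l m
  · obtain ⟨l, rfl, hl⟩ := h.lmor_ne hk
    have hlx : u l ≠ x := hl ▸ hk
    refine ⟨l + 1, by have := (nonerasing_rmor x).le_pos u l; omega, fun z hz => hz.image hg ?_⟩
    intro m
    rw [hom_lgen, ← h.isOccurrence_lmor (l + 1) m, pos_rmor_ne hlx]
    refine isOccurrence_succ (fun m hm => ?_) m
    rw [h.lmor_next hk, h.lmor_next (hm ▸ hk)]

/-- The derivated words of all prefixes of `u`, the empty one included, are derivated words of
nonempty prefixes of `lmor x u`. -/
theorem IsImage.exists_derivesTo_lmor' (h : IsImage (lmor x) u v) (n : ℕ) :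
    ∃ n' > 0, ∀ z, DerivesTo u n z → DerivesTo v n' z := by
  have hg : IsImage (lgen x).hom u v := by rwa [hom_lgen]
  refine ⟨pos (rmor x) u n + 1, Nat.succ_pos _, fun z hz => hz.image hg fun m => ?_⟩
  rw [hom_lgen]
  exact h.isOccurrence_lmor n m

/-- If `u` does not begin with `x`, each nonempty prefix of `rmor x u` has the derivated word of a
nonempty prefix of `u`. -/
theorem IsImage.exists_derivesTo_rmor (h : IsImage (rmor x) u v) (hu : u 0 ≠ x) {n : ℕ}
    (hn : 0 < n) : ∃ n' > 0, n' ≤ n ∧ ∀ z, DerivesTo u n' z → DerivesTo v n z := by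
  have hg : IsImage (rgen x).hom u v := by rwa [hom_rgen]
  obtain ⟨k, rfl⟩ := Nat.exists_eq_add_of_lt hn
  rw [zero_add] at *
  by_cases hk : v k = x
  · obtain ⟨l, hl⟩ := h.rmor_eq hk
    refine ⟨l + 1, l.succ_pos, hl ▸ (nonerasing_rmor x).le_pos u (l + 1),
      fun z hz => hz.image hg fun m => ?_⟩
    rw [hom_rgen, hl]
    exact h.isOccurrence_rmor hu l.succ_pos m
  · obtain ⟨l, rfl, hl⟩ := h.rmor_ne hk
    have hlx : u l ≠ x := hl ▸ hk
    refine ⟨l + 1, l.succ_pos, Nat.succ_le_succ ((nonerasing_rmor x).le_pos u l),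
      fun z hz => hz.image hg fun m => ?_⟩
    rw [hom_rgen, ← h.isOccurrence_rmor hu l.succ_pos m, pos_rmor_ne hlx]
    refine isOccurrence_succ (fun m hm => ?_) m
    rw [h.rmor_next hk, h.rmor_next (hm ▸ hk)]

theorem IsImage.exists_derivesTo_rmor' (h : IsImage (rmor x) u v) (hu : u 0 ≠ x) {n : ℕ}
    (hn : 0 < n) : ∃ n' > 0, ∀ z, DerivesTo u n z → DerivesTo v n' z := by
  have hg : IsImage (rgen x).hom u v := by rwa [hom_rgen]
  refine ⟨pos (rmor x) u n, hn.trans_le ((nonerasing_rmor x).le_pos u n),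
    fun z hz => hz.image hg fun m => ?_⟩
  rw [hom_rgen]
  exact h.isOccurrence_rmor hu hn m

end Occurrences

/-! ### Derivated words -/

section Derivated

/-- A binary word, as a word over the alphabet `ℕ`. -/
def toNat (z : ℕ → Fin 2) : ℕ → ℕ := fun i => z i

theorem InjOnWords.injective_of {A B : Type*} {ψ : FreeMonoid A →* FreeMonoid B}
    (hn : Nonerasing ψ) (h : InjOnWords ψ) : Function.Injective fun x => ψ (of x) := by
  intro x y hxy
  simp only at hxy
  have hpos : ∀ n, pos ψ (fun _ => x) n = pos ψ (fun _ => y) n := fun n => by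
    induction n with
    | zero => simp
    | succ n ih => rw [pos_succ, pos_succ, ih, hxy]
  -- the images of the constant words `xxx⋯` and `yyy⋯` coincide
  obtain ⟨v, hv⟩ := hn.exists_isImage (fun _ => x)
  have hv' : IsImage ψ (fun _ => y) v := by
    rw [isImage_iff hn] at hv ⊢
    intro n
    rw [← hpos, ← hxy, hv n]
  exact congrFun (h _ _ _ hv hv') 0

theorem returnWords_of_pos {A B : Type*} {ψ : FreeMonoid A →* FreeMonoid B} (hn : Nonerasing ψ)
    {z : ℕ → A} {u : ℕ → B} (h : IsImage ψ z u) {p : FreeMonoid B}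
    (hp : ∀ m, IsOccurrence u p m ↔ ∃ l, m = pos ψ z l) :
    returnWords u p = Set.range fun l => ψ (of (z l)) := by
  have hlt : ∀ l, factor u (pos ψ z l) (pos ψ z (l + 1) - pos ψ z l) = ψ (of (z l)) := fun l => by
    rw [pos_succ, Nat.add_sub_cancel_left, (isImage_iff hn).1 h l]
  have hmono := hn.strictMono_pos z
  ext r
  constructor
  · rintro ⟨i, j, hij, hi, hj, hk, rfl⟩
    obtain ⟨l, rfl⟩ := (hp i).1 hi
    obtain ⟨l', rfl⟩ := (hp j).1 hj
    have h1 : l < l' := hmono.lt_iff_lt.1 hij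
    obtain rfl | h2 := (Nat.succ_le_of_lt h1).eq_or_lt
    · exact ⟨l, (hlt l).symm⟩
    · exact absurd ((hp _).2 ⟨l + 1, rfl⟩) (hk _ (hmono l.lt_succ_self) (hmono h2))
  · rintro ⟨l, rfl⟩
    refine ⟨_, _, hmono l.lt_succ_self, (hp _).2 ⟨l, rfl⟩, (hp _).2 ⟨l + 1, rfl⟩, ?_,
      (hlt l).symm⟩
    intro k h1 h2 hk
    obtain ⟨l', rfl⟩ := (hp k).1 hk
    have := hmono.lt_iff_lt.1 h1
    have := hmono.lt_iff_lt.1 h2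
    omega

theorem isImage_congr {A A' B : Type*} {ψ : FreeMonoid A →* FreeMonoid B}
    {φ : FreeMonoid A' →* FreeMonoid B} {z : ℕ → A} {z' : ℕ → A'}
    (h : ∀ i, ψ (of (z i)) = φ (of (z' i))) (u : ℕ → B) : IsImage ψ z u ↔ IsImage φ z' u := by
  have : ∀ n, ψ (factor z 0 n) = φ (factor z' 0 n) := fun n => by
    induction n with
    | zero => simp
    | succ n ih => rw [factor_succ, factor_succ, map_mul, map_mul, ih, h]
  simp only [IsImage, this]

variable {u z : ℕ → Fin 2} {n : ℕ}

theorem range_of_two (h0 : ∃ i, z i = 0) (h1 : ∃ i, z i = 1) {B : Type*} (f : Fin 2 → B) :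
    (Set.range fun i => f (z i)) = Set.range f := by
  have : Function.Surjective z := by
    intro a
    fin_cases a
    exacts [h0, h1]
  exact this.range_comp f

theorem DerivesTo.isDerivated (h : DerivesTo u n z) (h0 : ∃ i, z i = 0) (h1 : ∃ i, z i = 1) :
    IsDerivated u (factor u 0 n) (toNat z) := by
  obtain ⟨w, hw, hocc⟩ := h
  have hr := returnWords_of_pos (nonerasing_phiHom w) hw hocc
  have hinj := (injOnWords_phiHom w).injective_of (nonerasing_phiHom w)
  rw [range_of_two h0 h1 (fun a => phiHom w (of a))] at hr
  have hcast : ∀ a : Fin 2, Fin.ofNat 2 (a : ℕ) = a := fun a => by fin_cases a <;> rfl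
  refine ⟨2, fun i => phiHom w (of (Fin.ofNat 2 i)), ⟨?_, ?_, ?_⟩, fun i => (z i).2, ?_⟩
  · intro i _
    rw [hr]
    exact ⟨_, rfl⟩
  · intro i hi j hj hij
    have h := congrArg Fin.val (hinj hij)
    simp only [Set.mem_Iio] at hi hj
    simpa [Nat.mod_eq_of_lt hi, Nat.mod_eq_of_lt hj] using h
  · rw [hr]
    rintro _ ⟨a, rfl⟩
    exact ⟨a, a.2, by simp only [hcast]⟩
  · refine (isImage_congr (fun i => ?_) u).1 hw
    rw [FreeMonoid.lift_eval_of, toNat, hcast]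

theorem exists_perm_of_ne {a b : ℕ} (h : a ≠ b) : ∃ σ : Equiv.Perm ℕ, σ a = 0 ∧ σ b = 1 := by
  refine ⟨(Equiv.swap a 0).trans (Equiv.swap (Equiv.swap a 0 b) 1), ?_, ?_⟩
  · have : Equiv.swap a 0 b ≠ 0 := fun hb =>
      h ((Equiv.swap a 0).injective ((Equiv.swap_apply_left a 0).trans hb.symm))
    simp [Equiv.swap_apply_of_ne_of_ne this.symm]
  · simp

theorem DerivesTo.equiv (h : DerivesTo u n z) (h0 : ∃ i, z i = 0) (h1 : ∃ i, z i = 1)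
    {d : ℕ → ℕ} (hd : IsDerivated u (factor u 0 n) d) :
    Quotient.mk letterSetoid d = Quotient.mk letterSetoid (toNat z) := by
  obtain ⟨w, hw, hocc⟩ := h
  obtain ⟨k, r, hr, hdk, himg⟩ := hd
  rw [returnWords_of_pos (nonerasing_phiHom w) hw hocc] at hr
  have hmem : ∀ i, ∃ a, r (d i) = phiHom w (of a) := fun i => by
    obtain ⟨l, hl⟩ := hr.mapsTo (hdk i)
    exact ⟨z l, hl.symm⟩
  choose a ha using hmem
  have hz : a = z := by
    refine injOnWords_phiHom w _ _ u ?_ hw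
    refine (isImage_congr (fun i => ?_) u).1 himg
    rw [FreeMonoid.lift_eval_of, ha]
  subst hz
  have hda : ∀ i j, a i = a j → d i = d j := fun i j hij =>
    hr.injOn (hdk i) (hdk j) (by rw [ha, ha, hij])
  obtain ⟨i0, hi0⟩ := h0
  obtain ⟨i1, hi1⟩ := h1
  have hne : d i0 ≠ d i1 := fun he => by
    have h2 := (injOnWords_phiHom w).injective_of (nonerasing_phiHom w)
      ((ha i0).symm.trans ((congrArg r he).trans (ha i1)))
    rw [hi0, hi1] at h2
    exact absurd h2 (by decide)
  obtain ⟨σ, hσ0, hσ1⟩ := exists_perm_of_ne hne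
  refine Quotient.sound ⟨σ, fun i => ?_⟩
  have h01 : ∀ b : Fin 2, b = 0 ∨ b = 1 := by decide
  rcases h01 (a i) with hi | hi
  · rw [hda i i0 (hi.trans hi0.symm), hσ0, toNat, hi]; rfl
  · rw [hda i i1 (hi.trans hi1.symm), hσ1, toNat, hi]; rfl

end Derivated

/-! ### Derivated words of directed sequences of words -/

section Directed

theorem eq_of_ne_of_ne {x y z : Fin 2} (hxy : x ≠ y) (hz : z ≠ y) : z = x := by
  revert x y z; decide

/-- The sequence of words `s` is directed by `X`: `s i` is the image of `s (i + 1)` by `lmor y` if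
`X i` holds, and by `rmor x` otherwise, and both cases occur infinitely often. -/
structure IsDirected (x y : Fin 2) (X : ℕ → Prop) (s : ℕ → ℕ → Fin 2) : Prop where
  ne : x ≠ y
  left : ∀ i, X i → IsImage (lmor y) (s (i + 1)) (s i)
  right : ∀ i, ¬ X i → IsImage (rmor x) (s (i + 1)) (s i)
  exists_left : ∀ i, ∃ t, X (i + t)
  exists_right : ∀ i, ∃ t, ¬ X (i + t)

namespace IsDirected

variable {x y : Fin 2} {X : ℕ → Prop} {s : ℕ → ℕ → Fin 2}

theorem apply_zero (h : IsDirected x y X s) (i : ℕ) : s i 0 = y := by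
  obtain ⟨t, ht⟩ := h.exists_left i
  induction t generalizing i with
  | zero => exact (isImage_lmor_iff.1 (h.left i ht)).1
  | succ t ih =>
    by_cases hi : X i
    · exact (isImage_lmor_iff.1 (h.left i hi)).1
    · have h1 := (h.right i hi).rmor_pos 0
      rw [pos_zero] at h1
      rw [h1]
      exact ih (i + 1) (by rwa [add_right_comm, add_assoc])

theorem apply_one_of_left (h : IsDirected x y X s) {i : ℕ} (hi : X i) : s i 1 = y := by
  have h1 := (isImage_lmor_iff.1 (h.left i hi)).2.rmor_pos 0
  rw [h.apply_zero, pos_zero] at h1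
  exact h1

theorem apply_one_of_right (h : IsDirected x y X s) {i : ℕ} (hi : ¬ X i) : s i 1 = x := by
  simpa using (h.right i hi).rmor_pos_add_one (n := 0) (by rw [h.apply_zero]; exact h.ne.symm)

theorem exists_eq_right (h : IsDirected x y X s) (i : ℕ) : ∃ m, s i m = x := by
  obtain ⟨t, ht⟩ := h.exists_right i
  induction t generalizing i with
  | zero => exact ⟨1, h.apply_one_of_right ht⟩
  | succ t ih =>
    by_cases hi : X i
    · obtain ⟨m, hm⟩ := ih (i + 1) (by rwa [add_right_comm, add_assoc])
      exact ⟨_, ((isImage_lmor_iff.1 (h.left i hi)).2.rmor_pos m).trans hm⟩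
    · exact ⟨1, h.apply_one_of_right hi⟩

theorem exists_eq (h : IsDirected x y X s) (i : ℕ) (a : Fin 2) : ∃ m, s i m = a := by
  by_cases ha : a = y
  · exact ⟨0, (h.apply_zero i).trans ha.symm⟩
  · rw [eq_of_ne_of_ne h.ne ha]
    exact h.exists_eq_right i

/-- Equal words of a directed sequence are desubstituted in the same way. -/
theorem left_iff_of_eq (h : IsDirected x y X s) {i j : ℕ} (hij : s i = s j) (m : ℕ) :
    X (i + m) ↔ X (j + m) := by
  have key : ∀ {i j}, s i = s j → (X i ↔ X j) ∧ s (i + 1) = s (j + 1) := by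
    intro i j hij
    by_cases hi : X i <;> by_cases hj : X j
    · have h2 := h.left j hj
      rw [← hij] at h2
      exact ⟨iff_of_true hi hj, injOnWords_lmor y _ _ _ (h.left i hi) h2⟩
    · have := h.apply_one_of_right hj
      rw [← hij, h.apply_one_of_left hi] at this
      exact absurd this.symm h.ne
    · have := h.apply_one_of_right hi
      rw [hij, h.apply_one_of_left hj] at this
      exact absurd this.symm h.ne
    · have h2 := h.right j hj
      rw [← hij] at h2
      exact ⟨iff_of_false hi hj, injOnWords_rmor x _ _ _ (h.right i hi) h2⟩
  have hs : ∀ m, s (i + m) = s (j + m) := fun m => by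
    induction m with
    | zero => exact hij
    | succ m ih => exact (key ih).2
  exact (key (hs m)).1

theorem eq_of_equiv (h : IsDirected x y X s) {i j : ℕ}
    (hij : Quotient.mk letterSetoid (toNat (s i)) = Quotient.mk letterSetoid (toNat (s j))) :
    s i = s j := by
  obtain ⟨σ, hσ⟩ := Quotient.exact hij
  have hy : σ (y : ℕ) = (y : ℕ) := by
    have := hσ 0
    rwa [toNat, toNat, h.apply_zero, h.apply_zero, eq_comm] at this
  have hx : σ (x : ℕ) = (x : ℕ) := by
    obtain ⟨m, hm⟩ := h.exists_eq_right i
    have h1 := hσ m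
    rw [toNat, toNat, hm] at h1
    have h2 : s j m ≠ y := fun he => by
      rw [he, ← hy] at h1
      exact h.ne (Fin.val_injective (σ.injective h1.symm))
    rw [← h1, eq_of_ne_of_ne h.ne h2]
  funext m
  have h1 := hσ m
  simp only [toNat] at h1
  apply Fin.val_injective
  by_cases hm : s i m = y
  · rw [h1, hm, hy]
  · rw [h1, eq_of_ne_of_ne h.ne hm, hx]

/-- Every nonempty prefix of `s i` derives to the word that follows a desubstitution of `lmor y`. -/
theorem exists_left_derivesTo (h : IsDirected x y X s) {n : ℕ} (hn : 0 < n) (i : ℕ) :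
    ∃ j ≥ i, X j ∧ DerivesTo (s i) n (s (j + 1)) := by
  induction n using Nat.strong_induction_on generalizing i with
  | _ n ihn =>
    have hleft : ∀ i, X i → ∃ j ≥ i, X j ∧ DerivesTo (s i) n (s (j + 1)) := by
      intro i hi
      obtain ⟨n', hn', hz⟩ := (h.left i hi).exists_derivesTo_lmor hn
      rcases Nat.eq_zero_or_pos n' with rfl | hpos
      · exact ⟨i, le_rfl, hi, hz _ (derivesTo_zero _)⟩
      · obtain ⟨j, hj, hX, hd⟩ := ihn n' hn' hpos (i + 1)
        exact ⟨j, by omega, hX, hz _ hd⟩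
    obtain ⟨t, ht⟩ := h.exists_left i
    induction t generalizing i with
    | zero => exact hleft i ht
    | succ t iht =>
      by_cases hi : X i
      · exact hleft i hi
      · obtain ⟨n', hpos, hn', hz⟩ := (h.right i hi).exists_derivesTo_rmor
          (by rw [h.apply_zero]; exact h.ne.symm) hn
        obtain ⟨j, hj, hX, hd⟩ : ∃ j ≥ i + 1, X j ∧ DerivesTo (s (i + 1)) n' (s (j + 1)) := by
          rcases hn'.lt_or_eq with hlt | rfl
          · exact ihn n' hlt hpos (i + 1)
          · exact iht (i + 1) (by rwa [add_right_comm, add_assoc])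
        exact ⟨j, by omega, hX, hz _ hd⟩

theorem exists_derivesTo_of_left (h : IsDirected x y X s) {i j : ℕ} (hij : i ≤ j) (hj : X j) :
    ∃ n > 0, DerivesTo (s i) n (s (j + 1)) := by
  induction hij using Nat.decreasingInduction with
  | self =>
    obtain ⟨n, hn, hz⟩ := (h.left j hj).exists_derivesTo_lmor' 0
    exact ⟨n, hn, hz _ (derivesTo_zero _)⟩
  | of_succ i _ ih =>
    obtain ⟨n, hn, hd⟩ := ih
    by_cases hi : X i
    · obtain ⟨n', hn', hz⟩ := (h.left i hi).exists_derivesTo_lmor' n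
      exact ⟨n', hn', hz _ hd⟩
    · obtain ⟨n', hn', hz⟩ := (h.right i hi).exists_derivesTo_rmor'
        (by rw [h.apply_zero]; exact h.ne.symm) hn
      exact ⟨n', hn', hz _ hd⟩

end IsDirected

end Directed

/-! ### Derivated words of towers -/

section Tower

/-- The words `U i` all begin with the letter `z`, and `U i` is the image of `U (i + 1)` by
`rmor (c i)`; both values of `c` occur infinitely often. -/
structure IsTower (z : Fin 2) (c : ℕ → Fin 2) (U : ℕ → ℕ → Fin 2) : Prop where
  apply_zero : ∀ i, U i 0 = z
  image : ∀ i, IsImage (rmor (c i)) (U (i + 1)) (U i)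
  exists_eq : ∀ i a, ∃ t, c (i + t) = a

namespace IsTower

variable {z y : Fin 2} {c : ℕ → Fin 2} {U : ℕ → ℕ → Fin 2}

/-- Deletion of the first letters turns the morphisms `rmor y` of a tower into `lmor y`. -/
theorem isDirected (h : IsTower z c U) (hzy : z ≠ y) :
    IsDirected z y (fun i => c i = y) fun i => shift (U i) where
  ne := hzy
  left i hi := by
    have := (h.image i).shift_ne (by rw [h.apply_zero, hi]; exact hzy)
    rwa [hi] at this
  right i hi := by
    have hc := eq_of_ne_of_ne hzy hi
    have := (h.image i).shift_self (by rw [h.apply_zero, hc])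
    rwa [hc] at this
  exists_left i := h.exists_eq i y
  exists_right i := by
    obtain ⟨t, ht⟩ := h.exists_eq i z
    exact ⟨t, by rw [ht]; exact hzy⟩

theorem exists_derivesTo (h : IsTower z c U) (hzy : z ≠ y) {k i : ℕ} (hk : c k = z)
    (hlt : ∀ j < k, c j = y) (hi : i ≤ k) {n : ℕ} (hn : 0 < n) :
    ∃ j, (j = k ∨ k < j ∧ c j = y) ∧ DerivesTo (U i) n (shift (U (j + 1))) := by
  induction hi using Nat.decreasingInduction generalizing n with
  | self =>
    have h1 := (h.image k).lmor_shift (by rw [h.apply_zero, hk])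
    obtain ⟨n', -, hz⟩ := h1.exists_derivesTo_lmor hn
    rcases Nat.eq_zero_or_pos n' with rfl | hpos
    · exact ⟨k, .inl rfl, hz _ (derivesTo_zero _)⟩
    · obtain ⟨j, hj, hc, hd⟩ := (h.isDirected hzy).exists_left_derivesTo hpos (k + 1)
      exact ⟨j, .inr ⟨hj, hc⟩, hz _ hd⟩
  | of_succ i hik ih =>
    obtain ⟨n', hpos, -, hz⟩ := (h.image i).exists_derivesTo_rmor
      (by rw [h.apply_zero, hlt i hik]; exact hzy) hn
    obtain ⟨j, hj, hd⟩ := ih hpos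
    exact ⟨j, hj, hz _ hd⟩

theorem exists_derivesTo' (h : IsTower z c U) (hzy : z ≠ y) {k i j : ℕ} (hk : c k = z)
    (hlt : ∀ j < k, c j = y) (hi : i ≤ k) (hj : j = k ∨ k < j ∧ c j = y) :
    ∃ n > 0, DerivesTo (U i) n (shift (U (j + 1))) := by
  induction hi using Nat.decreasingInduction with
  | self =>
    have h1 := (h.image k).lmor_shift (by rw [h.apply_zero, hk])
    have hd : ∃ n, DerivesTo (shift (U (k + 1))) n (shift (U (j + 1))) := by
      rcases hj with rfl | ⟨hj, hc⟩
      · exact ⟨0, derivesTo_zero _⟩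
      · obtain ⟨n, -, hd⟩ := (h.isDirected hzy).exists_derivesTo_of_left
          (Nat.succ_le_of_lt hj) hc
        exact ⟨n, hd⟩
    obtain ⟨n, hd⟩ := hd
    obtain ⟨n', hpos, hz⟩ := h1.exists_derivesTo_lmor' n
    exact ⟨n', hpos, hz _ hd⟩
  | of_succ i hik ih =>
    obtain ⟨n, hn, hd⟩ := ih
    obtain ⟨n', hpos, hz⟩ := (h.image i).exists_derivesTo_rmor'
      (by rw [h.apply_zero, hlt i hik]; exact hzy) hn
    exact ⟨n', hpos, hz _ hd⟩

/-- If `k` is the first index with `c k = z`, then the derivated words of `U 0` are the words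
`shift (U (j + 1))` for `j = k` and for those `j > k` with `c j ≠ z`. -/
theorem der_eq (h : IsTower z c U) (hzy : z ≠ y) {k : ℕ} (hk : c k = z)
    (hlt : ∀ j < k, c j = y) :
    Der (U 0) = (fun j => Quotient.mk letterSetoid (toNat (shift (U (j + 1))))) ''
      {j | j = k ∨ k < j ∧ c j = y} := by
  have hex := (h.isDirected hzy).exists_eq
  ext q
  constructor
  · rintro ⟨n, d, hn, hd, rfl⟩
    obtain ⟨j, hj, hz⟩ := h.exists_derivesTo hzy hk hlt k.zero_le hn
    exact ⟨j, hj, (hz.equiv (hex _ 0) (hex _ 1) hd).symm⟩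
  · rintro ⟨j, hj, rfl⟩
    obtain ⟨n, hn, hz⟩ := h.exists_derivesTo' hzy hk hlt k.zero_le hj
    exact ⟨n, _, hn, hz.isDerivated (hex _ 0) (hex _ 1), rfl⟩

/-- For a periodic tower whose period is a primitive word, the derivated words are counted by the
letters of the period. -/
theorem encard_der (h : IsTower z c U) (hzy : z ≠ y) {n : ℕ} (hc : ∀ i, c (i + n) = c i)
    (hU : ∀ i, U (i + n) = U i)
    (hprim : ∀ i < n, ∀ j < n, (∀ m, c (i + m) = c (j + m)) → i = j) (hz : ∃ i < n, c i = z) :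
    (Der (U 0)).encard = 1 + (((Finset.range n).filter fun i => c i = y).card : ℕ∞) := by
  classical
  obtain ⟨k, ⟨hkn, hk⟩, hmin⟩ : ∃ k, (k < n ∧ c k = z) ∧ ∀ j < k, ¬ (j < n ∧ c j = z) :=
    ⟨Nat.find hz, Nat.find_spec hz, fun j hj => Nat.find_min hz hj⟩
  have hlt : ∀ j < k, c j = y := fun j hj =>
    eq_of_ne_of_ne hzy.symm fun he => hmin j hj ⟨hj.trans hkn, he⟩
  set F : ℕ → Quotient letterSetoid :=
    fun j => Quotient.mk letterSetoid (toNat (shift (U (j + 1)))) with hF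
  have hFn : ∀ j, F (j + n) = F j := fun j => by
    simp only [hF]; rw [add_right_comm, hU]
  have hFmod : ∀ j, F (j % n) = F j := (show Function.Periodic F n from hFn).map_mod_nat
  have hcmod : ∀ j, c (j % n) = c j := (show Function.Periodic c n from hc).map_mod_nat
  have hnpos : 0 < n := by omega
  have himage : Der (U 0) = F '' ((insert k ((Finset.range n).filter fun i => c i = y) :
      Finset ℕ) : Set ℕ) := by
    rw [h.der_eq hzy hk hlt]
    ext q
    constructor
    · rintro ⟨j, hj, rfl⟩
      refine ⟨j % n, ?_, hFmod j⟩
      rcases hj with rfl | ⟨-, hj⟩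
      · simp [Nat.mod_eq_of_lt hkn]
      · simp [hcmod, hj, Nat.mod_lt _ hnpos]
    · rintro ⟨j, hj, rfl⟩
      simp only [Finset.coe_insert, Finset.coe_filter, Finset.mem_range, Set.mem_insert_iff,
        Set.mem_ofPred_eq] at hj
      rcases hj with rfl | ⟨hjn, hj⟩
      · exact ⟨j, .inl rfl, rfl⟩
      · exact ⟨j + n, .inr ⟨by omega, by rw [hc, hj]⟩, hFn j⟩
  have hinj : Set.InjOn F ((insert k ((Finset.range n).filter fun i => c i = y) :
      Finset ℕ) : Set ℕ) := by
    intro i hi j hj hij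
    have hlt' : ∀ i ∈ insert k ((Finset.range n).filter fun i => c i = y), i < n := by
      intro i hi
      rcases Finset.mem_insert.1 hi with rfl | hi
      · exact hkn
      · exact Finset.mem_range.1 (Finset.mem_filter.1 hi).1
    have hd := h.isDirected hzy
    have h1 := hd.left_iff_of_eq (hd.eq_of_equiv hij)
    have h2 : ∀ m, c (i + 1 + m) = c (j + 1 + m) := fun m => by
      by_cases hm : c (i + 1 + m) = y
      · rw [hm, (h1 m).1 hm]
      · rw [eq_of_ne_of_ne hzy hm, eq_of_ne_of_ne hzy (fun h' => hm ((h1 m).2 h'))]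
    refine hprim i (hlt' i hi) j (hlt' j hj) fun m => ?_
    have h3 := h2 (m + (n - 1))
    rwa [show i + 1 + (m + (n - 1)) = i + m + n by omega,
      show j + 1 + (m + (n - 1)) = j + m + n by omega, hc, hc] at h3
  have hnot : k ∉ (Finset.range n).filter fun i => c i = y := fun hmem =>
    hzy (hk.symm.trans (Finset.mem_filter.1 hmem).2)
  rw [himage, hinj.encard_image, Set.encard_coe_eq_coe_finsetCard,
    Finset.card_insert_of_notMem hnot]
  push_cast
  rw [add_comm]

end IsTower

end Tower

/-! ### Fixed points -/

section FixedPoints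

variable {A : Type*}

theorem pos_lt_of_isFixedPoint {ψ : FreeMonoid A →* FreeMonoid A} (hn : Nonerasing ψ) {z : A}
    (hlen : 1 < (ψ (of z)).length) {u : ℕ → A} (hu : u 0 = z) (n : ℕ) :
    n + 1 < pos ψ u (n + 1) := by
  induction n with
  | zero => simpa [pos, hu] using hlen
  | succ n ih => exact (Nat.succ_le_of_lt ih).trans_lt (hn.strictMono_pos u (Nat.lt_succ_self _))

theorem isFixedPoint_unique {ψ : FreeMonoid A →* FreeMonoid A} (hn : Nonerasing ψ) {z : A}
    (hlen : 1 < (ψ (of z)).length) {u v : ℕ → A} (hu : IsImage ψ u u) (hu0 : u 0 = z)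
    (hv : IsImage ψ v v) (hv0 : v 0 = z) : u = v := by
  have key : ∀ n, factor u 0 (n + 1) = factor v 0 (n + 1) := fun n => by
    induction n with
    | zero => simp [hu0, hv0]
    | succ n ih =>
      have h1 := hu.1 (n + 1)
      rw [ih] at h1
      have h2 := pos_lt_of_isFixedPoint hn hlen hv0 n
      have h3 := factor_inj.1 ((hv.1 (n + 1)).symm.trans h1)
      exact factor_inj.2 fun k hk => (h3 k (lt_of_lt_of_le hk h2)).symm
  funext n
  simpa using factor_inj.1 (key n) n (by omega)

theorem exists_isFixedPoint {ψ : FreeMonoid A →* FreeMonoid A} (hn : Nonerasing ψ) {z : A}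
    {t : FreeMonoid A} (ht : ψ (of z) = of z * t) (ht1 : t ≠ 1) :
    ∃ u, IsImage ψ u u ∧ u 0 = z := by
  have htl : 0 < t.length := Nat.pos_of_ne_zero fun h => ht1 (FreeMonoid.length_eq_zero.1 h)
  -- the prefixes `ψ^k(z)` of the fixed point
  let P : ℕ → FreeMonoid A := fun k => ψ^[k] (of z)
  have hP : ∀ k, P (k + 1) = ψ (P k) := fun k => Function.iterate_succ_apply' ψ k _
  have hpre : ∀ k, ∃ r, P (k + 1) = P k * r ∧ 0 < r.length := fun k => by
    induction k with
    | zero => exact ⟨t, ht, htl⟩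
    | succ k ih =>
      obtain ⟨r, hr, hr1⟩ := ih
      exact ⟨ψ r, by rw [hP (k + 1), hr, map_mul, ← hP, hr], hr1.trans_le (hn.length_le r)⟩
  have hpre' : ∀ k j, ∃ r, P (k + j) = P k * r := fun k j => by
    induction j with
    | zero => exact ⟨1, by simp⟩
    | succ j ih =>
      obtain ⟨r, hr⟩ := ih
      obtain ⟨r', hr', -⟩ := hpre (k + j)
      exact ⟨r * r', by rw [← add_assoc, hr', hr, mul_assoc]⟩
  have hlen : ∀ k, k < (P k).toList.length := fun k => by
    induction k with
    | zero => exact Nat.one_pos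
    | succ k ih =>
      obtain ⟨r, hr, hr1⟩ := hpre k
      rw [hr, FreeMonoid.toList_mul, List.length_append]
      change 0 < r.toList.length at hr1
      omega
  let u : ℕ → A := fun m => (P m).toList[m]'(hlen m)
  have hget : ∀ k m (h : m < (P k).toList.length), (P k).toList[m] = u m := by
    intro k m h
    obtain ⟨r, hr⟩ := hpre' k m
    obtain ⟨r', hr'⟩ := hpre' m k
    have h1 : (P k).toList[m]? = (P m).toList[m]? := by
      rw [← List.getElem?_append_left h (l₂ := r.toList), ← FreeMonoid.toList_mul, ← hr,
        ← List.getElem?_append_left (hlen m) (l₂ := r'.toList), ← FreeMonoid.toList_mul, ← hr',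
        add_comm]
    rw [List.getElem?_eq_getElem h, List.getElem?_eq_getElem (hlen m)] at h1
    exact Option.some_inj.1 h1
  have hPu : ∀ k, P k = factor u 0 (P k).length := fun k => by
    apply FreeMonoid.toList.injective
    apply List.ext_getElem
    · exact (length_factor u 0 _).symm
    · intro i h1 h2
      rw [getElem_factor, hget k i h1, zero_add]
  have h0 : u 0 = z := rfl
  refine ⟨u, ⟨fun n => ?_, fun m => ⟨m, by simpa using hn.length_le (factor u 0 m)⟩⟩, h0⟩
  have h1 : n ≤ (P n).length := (hlen n).le
  obtain ⟨j, hj⟩ := Nat.exists_eq_add_of_le h1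
  have h2 := hPu (n + 1)
  rw [hP, hPu n, hj, factor_add, map_mul, FreeMonoid.length_mul, factor_add,
    mul_inj_of_length (by simp)] at h2
  exact h2.1

end FixedPoints

/-! ### Sturmian morphisms -/

section Sturmian

variable {A : Type*}

/-- The finite word `p` is a factor of the infinite word `u`. -/
def IsFactor (u : ℕ → A) (p : FreeMonoid A) : Prop :=
  ∃ i, factor u i p.length = p

theorem isFactor_factor (u : ℕ → A) (i n : ℕ) : IsFactor u (factor u i n) :=
  ⟨i, by rw [length_factor]⟩

theorem IsFactor.right {u : ℕ → A} {p q : FreeMonoid A} (h : IsFactor u (p * q)) :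
    IsFactor u q := by
  obtain ⟨i, hi⟩ := h
  rw [FreeMonoid.length_mul, factor_add, mul_inj_of_length (by simp)] at hi
  exact ⟨_, hi.2⟩

theorem IsFactor.left {u : ℕ → A} {p q : FreeMonoid A} (h : IsFactor u (p * q)) :
    IsFactor u p := by
  obtain ⟨i, hi⟩ := h
  rw [FreeMonoid.length_mul, factor_add, mul_inj_of_length (by simp)] at hi
  exact ⟨_, hi.1⟩

/-- The finite word `p` is a right special factor of `u`: both of its extensions to the right are
factors of `u`. -/
def IsRightSpecial (u : ℕ → Fin 2) (p : FreeMonoid (Fin 2)) : Prop :=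
  ∀ a, IsFactor u (p * of a)

theorem IsRightSpecial.right {u : ℕ → Fin 2} {p q : FreeMonoid (Fin 2)}
    (h : IsRightSpecial u (p * q)) : IsRightSpecial u q := fun a => by
  have := h a
  rw [mul_assoc] at this
  exact this.right

theorem exists_mul_of_le_length {p : FreeMonoid A} {n : ℕ} (h : n ≤ p.length) :
    ∃ q r, p = q * r ∧ r.length = n := by
  refine ⟨FreeMonoid.ofList (p.toList.take (p.length - n)),
    FreeMonoid.ofList (p.toList.drop (p.length - n)), ?_, ?_⟩
  · rw [← FreeMonoid.ofList_append, List.take_append_drop, FreeMonoid.ofList_toList]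
  · simp only [FreeMonoid.length, FreeMonoid.toList_ofList, List.length_drop]
    have : n ≤ p.toList.length := h
    omega

theorem mul_of_inj {p q : FreeMonoid A} {a b : A} : p * of a = q * of b ↔ p = q ∧ a = b := by
  constructor
  · intro h
    have hl := congrArg FreeMonoid.length h
    simp only [FreeMonoid.length_mul, FreeMonoid.length_of] at hl
    rw [mul_inj_of_length (by omega)] at h
    exact ⟨h.1, FreeMonoid.of_injective h.2⟩
  · rintro ⟨rfl, rfl⟩; rfl

/-- The first difference of the factor complexity counts the right special factors. -/
theorem encard_factor_succ (u : ℕ → Fin 2) (n : ℕ) :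
    (Set.range fun i => factor u i n).encard + {p | p.length = n ∧ IsRightSpecial u p}.encard =
      (Set.range fun i => factor u i (n + 1)).encard := by
  let S : Fin 2 → Set (FreeMonoid (Fin 2)) := fun a => {p | p.length = n ∧ IsFactor u (p * of a)}
  have h1 : (Set.range fun i => factor u i n) = S 0 ∪ S 1 := by
    ext p
    constructor
    · rintro ⟨i, rfl⟩
      have h : ∀ a, a = u (i + n) → factor u i n ∈ S a := by
        rintro a rfl
        refine ⟨length_factor u i n, ?_⟩
        rw [← factor_succ]
        exact isFactor_factor u i (n + 1)
      have h01 : ∀ a : Fin 2, 0 = a ∨ 1 = a := by decide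
      exact (h01 (u (i + n))).imp (h 0) (h 1)
    · rintro (⟨rfl, hp⟩ | ⟨rfl, hp⟩) <;> exact hp.left
  have h2 : {p | p.length = n ∧ IsRightSpecial u p} = S 0 ∩ S 1 := by
    ext p
    constructor
    · rintro ⟨hl, hp⟩
      exact ⟨⟨hl, hp 0⟩, ⟨hl, hp 1⟩⟩
    · rintro ⟨⟨hl, h0⟩, -, h1⟩
      refine ⟨hl, fun a => ?_⟩
      fin_cases a
      exacts [h0, h1]
  have h3 : (Set.range fun i => factor u i (n + 1)) =
      (fun p => p * of 0) '' S 0 ∪ (fun p => p * of 1) '' S 1 := by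
    ext p
    constructor
    · rintro ⟨i, rfl⟩
      have h : ∀ a, a = u (i + n) → factor u i (n + 1) ∈ (fun p => p * of a) '' S a := by
        rintro a rfl
        refine ⟨factor u i n, ⟨length_factor u i n, ?_⟩, (factor_succ u i n).symm⟩
        rw [← factor_succ]
        exact isFactor_factor u i (n + 1)
      have h01 : ∀ a : Fin 2, 0 = a ∨ 1 = a := by decide
      exact (h01 (u (i + n))).imp (h 0) (h 1)
    · rintro (⟨q, ⟨rfl, i, hi⟩, rfl⟩ | ⟨q, ⟨rfl, i, hi⟩, rfl⟩) <;>
      exact ⟨i, by simpa using hi⟩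
  have hdisj : Disjoint ((fun p => p * of 0) '' S 0) ((fun p => p * of 1) '' S 1) := by
    rw [Set.disjoint_left]
    rintro _ ⟨p, -, rfl⟩ ⟨q, -, hq⟩
    exact absurd (mul_of_inj.1 hq).2 (by decide)
  have hinj : ∀ a : Fin 2, Function.Injective fun p : FreeMonoid (Fin 2) => p * of a :=
    fun a p q h => (mul_of_inj.1 h).1
  rw [h1, h2, Set.encard_union_add_encard_inter, h3, Set.encard_union_eq hdisj,
    (hinj 0).encard_image, (hinj 1).encard_image]

/-- Sturmian words are the binary words with exactly one right special factor of each length. -/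
theorem isSturmian_iff {u : ℕ → Fin 2} :
    IsSturmian u ↔ ∀ n, ∃! p, p.length = n ∧ IsRightSpecial u p := by
  have hone : ∀ n, (∃! p, p.length = n ∧ IsRightSpecial u p) ↔
      {p | p.length = n ∧ IsRightSpecial u p}.encard = 1 := fun n => by
    rw [Set.encard_eq_one]
    constructor
    · rintro ⟨p, hp, h⟩
      exact ⟨p, Set.eq_singleton_iff_unique_mem.2 ⟨hp, h⟩⟩
    · rintro ⟨p, h⟩
      exact ⟨p, (Set.eq_singleton_iff_unique_mem.1 h)⟩
  simp only [hone]
  constructor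
  · intro h n
    have h1 := encard_factor_succ u n
    rw [h n, h (n + 1)] at h1
    have hfin : ((n : ℕ∞) + 1) ≠ ⊤ := by
      exact_mod_cast ENat.natCast_ne_top (n + 1)
    push_cast at h1
    exact (ENat.addLECancellable_of_ne_top hfin).inj.1 h1
  · intro h n
    induction n with
    | zero => simp
    | succ n ih => rw [← encard_factor_succ, ih, h n]; push_cast; rfl

variable {x : Fin 2} {u v : ℕ → Fin 2}

theorem IsImage.isRightSpecial_rmor (h : IsImage (rmor x) u v) {p : FreeMonoid (Fin 2)}
    (hp : IsRightSpecial u p) : IsRightSpecial v (rmor x p) := fun a => by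
  obtain ⟨i, hi⟩ := hp a
  obtain ⟨t, ht⟩ := exists_rmor_of x a
  have h1 := h.factor_pos i (p * of a).length
  rw [hi, map_mul, ht, ← mul_assoc] at h1
  exact IsFactor.left (q := t) ⟨_, h1⟩

theorem exists_mul_rmor (x : Fin 2) (p : FreeMonoid (Fin 2)) (hp : p ≠ 1) :
    ∃ q, rmor x p = q * of x := by
  obtain ⟨z, r, rfl⟩ := exists_of_mul hp
  have h : ∀ r, ∃ q, of x * rmor x r = q * of x := fun r => ⟨_, of_mul_rmor x r⟩
  obtain ⟨q, hq⟩ := h r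
  by_cases hz : z = x
  · exact ⟨q, by rw [map_mul, hz, rmor_self, hq]⟩
  · exact ⟨of z * q, by rw [map_mul, rmor_ne hz, mul_assoc, hq, mul_assoc]⟩

theorem exists_mul_of_mul_eq {a b c d : FreeMonoid A} (h : a * b = c * d)
    (hl : b.length ≤ d.length) : ∃ e, d = e * b ∧ a = c * e := by
  obtain ⟨e, b', rfl, hb⟩ := exists_mul_of_le_length hl
  have := congrArg FreeMonoid.length h
  simp only [FreeMonoid.length_mul] at this
  rw [← mul_assoc, mul_inj_of_length (by simp; omega)] at h
  exact ⟨e, by rw [h.2], h.1⟩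

theorem exists_mul_of {p : FreeMonoid A} (hp : p ≠ 1) : ∃ q a, p = q * of a := by
  have : 1 ≤ p.length := Nat.one_le_iff_ne_zero.2 fun h => hp (FreeMonoid.length_eq_zero.1 h)
  obtain ⟨q, r, rfl, hr⟩ := exists_mul_of_le_length this
  obtain ⟨a, rfl⟩ := FreeMonoid.length_eq_one.1 hr
  exact ⟨q, a, rfl⟩

theorem length_common_suffix_le {b : Fin 2} (hb : b ≠ x) {p q r s t : FreeMonoid (Fin 2)}
    (hp : rmor x (p * of x) = s * r) (hq : rmor x (q * of b) = t * r) : r.length ≤ 1 := by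
  by_contra! hr
  rw [map_mul, rmor_self] at hp
  rw [map_mul, rmor_ne hb] at hq
  obtain ⟨e, rfl, -⟩ := exists_mul_of_mul_eq hq (by simp; omega)
  rw [← mul_assoc, ← mul_assoc, mul_of_inj] at hp
  have hp1 : p ≠ 1 := by
    rintro rfl
    have := congrArg FreeMonoid.length hp.1
    simp at this
  obtain ⟨g, hg⟩ := exists_mul_rmor x p hp1
  rw [hg, mul_of_inj] at hp
  exact hb hp.1.2.symm

/-- A common suffix of `rmor x p` and `rmor x q` is a suffix of `x · rmor x c`, where `c` is a
common suffix of `p` and `q`. -/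
theorem exists_common_suffix {p q r s t : FreeMonoid (Fin 2)}
    (hp : rmor x p = s * r) (hq : rmor x q = t * r) :
    ∃ c p' q' r', p = p' * c ∧ q = q' * c ∧ of x * rmor x c = r' * r := by
  have hshort : ∀ {p q r s}, rmor x p = s * r → p ≠ 1 → r.length ≤ 1 →
      ∃ c p' q' r', p = p' * c ∧ q = q' * c ∧ of x * rmor x c = r' * r := by
    intro p q r s hp hp1 hr
    obtain ⟨e, he⟩ := exists_mul_rmor x p hp1
    obtain ⟨r', hr', -⟩ := exists_mul_of_mul_eq (hp.symm.trans he) hr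
    exact ⟨1, p, q, r', by simp, by simp, by simpa using hr'⟩
  have hone : ∀ {p q r}, r = 1 →
      ∃ c p' q' r', p = p' * c ∧ q = q' * c ∧ of x * rmor x c = r' * r := by
    rintro p q _ rfl
    exact ⟨1, p, q, of x, by simp, by simp, by simp⟩
  have hempty : ∀ {p r s}, p = 1 → rmor x p = s * r → r = 1 := by
    rintro _ r s rfl h
    have := congrArg FreeMonoid.length h
    rw [map_one, FreeMonoid.length_one, FreeMonoid.length_mul] at this
    exact FreeMonoid.length_eq_zero.1 (by omega)
  induction hn : p.length generalizing p q r s t with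
  | zero => exact hone (hempty (FreeMonoid.length_eq_zero.1 hn) hp)
  | succ n ih =>
    have hp1 : p ≠ 1 := fun h => by simp [h] at hn
    by_cases hq1 : q = 1
    · exact hone (hempty hq1 hq)
    obtain ⟨p, a, rfl⟩ := exists_mul_of hp1
    obtain ⟨q, b, rfl⟩ := exists_mul_of hq1
    by_cases hab : a = b
    · subst hab
      rw [map_mul] at hp hq
      rcases le_total r.length (rmor x (of a)).length with hr | hr
      · obtain ⟨e, he, -⟩ := exists_mul_of_mul_eq hp.symm hr
        exact ⟨of a, p, q, of x * e, rfl, rfl, by rw [he, mul_assoc]⟩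
      · obtain ⟨e, rfl, he⟩ := exists_mul_of_mul_eq hp hr
        rw [← mul_assoc] at hq
        have he' : rmor x q = t * e := by
          refine (mul_inj_of_length ?_).1 hq |>.1
          have := congrArg FreeMonoid.length hq
          simp only [FreeMonoid.length_mul] at this ⊢
          omega
        obtain ⟨c, p', q', r', rfl, rfl, h'⟩ := ih he he' (by simpa using hn)
        exact ⟨c * of a, p', q', r', by rw [mul_assoc], by rw [mul_assoc],
          by rw [map_mul, ← mul_assoc, h', mul_assoc]⟩
    · refine hshort hp hp1 ?_
      by_cases ha : a = x
      · subst ha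
        exact length_common_suffix_le (Ne.symm hab) hp hq
      · obtain rfl : b = x := by
          exact eq_of_ne_of_ne (Ne.symm ha) fun h => hab h.symm
        exact length_common_suffix_le ha hq hp

/-- Right special factors of `rmor x u` come from right special factors of `u`. -/
theorem IsImage.exists_isRightSpecial (h : IsImage (rmor x) u v) {q : FreeMonoid (Fin 2)}
    (hq : IsRightSpecial v q) (hq1 : q ≠ 1) :
    ∃ c r, IsRightSpecial u c ∧ of x * rmor x c = r * q := by
  obtain ⟨y, hy⟩ : ∃ y : Fin 2, y ≠ x :=
    (by decide : ∀ x : Fin 2, ∃ y, y ≠ x) x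
  have hocc : ∀ a, ∃ i, factor v i q.length = q ∧ v (i + q.length) = a := fun a => by
    obtain ⟨i, hi⟩ := hq a
    rw [FreeMonoid.length_mul, FreeMonoid.length_of, factor_succ, mul_of_inj] at hi
    exact ⟨i, hi⟩
  obtain ⟨m, hm⟩ : ∃ m, q.length = m + 1 :=
    Nat.exists_eq_succ_of_ne_zero fun h => hq1 (FreeMonoid.length_eq_zero.1 h)
  obtain ⟨i, hi, hiy⟩ := hocc y
  obtain ⟨j, hj, hjx⟩ := hocc x
  obtain ⟨k, hk, hky⟩ := h.rmor_ne (hiy ▸ hy)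
  have hlast : v (i + m) = x := by
    by_contra hne
    have := h.rmor_next hne
    rw [add_assoc, ← hm, hiy] at this
    exact hy this
  have hlast' : v (j + m) = x := by
    rw [← hlast]
    exact factor_inj.1 (hj.trans hi.symm) m (by omega)
  obtain ⟨l, hl⟩ := h.rmor_eq hlast'
  have hlx : u (l + 1) = x := by
    rw [← h.rmor_pos, ← hl, add_assoc, ← hm, hjx]
  have h1 : rmor x (factor u 0 k) = factor v 0 i * q := by
    have := h.1 k
    rw [← pos, ← hk, factor_add, zero_add, hi] at this
    exact this
  have h2 : rmor x (factor u 0 (l + 1)) = factor v 0 j * q := by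
    have := h.1 (l + 1)
    rw [← pos, ← hl, add_assoc, ← hm] at this
    rw [this, factor_add, zero_add, hj]
  obtain ⟨c, p', q', r', hp', hq', hr'⟩ := exists_common_suffix h1 h2
  refine ⟨c, r', fun a => ?_, hr'⟩
  by_cases ha : a = x
  · have h3 := isFactor_factor u 0 (l + 1 + 1)
    rw [factor_succ, hq', zero_add, hlx, mul_assoc] at h3
    rw [ha]
    exact h3.right
  · have h3 := isFactor_factor u 0 (k + 1)
    rw [factor_succ, hp', zero_add, hky, hiy, mul_assoc] at h3
    rw [eq_of_ne_of_ne hy ha]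
    exact h3.right

theorem IsImage.isSturmian_rmor (h : IsImage (rmor x) u v) (hu : IsSturmian u) :
    IsSturmian v := by
  rw [isSturmian_iff] at hu ⊢
  have hsuff : ∀ c c', IsRightSpecial u c → IsRightSpecial u c' → c.length ≤ c'.length →
      ∃ g, of x * rmor x c' = g * (of x * rmor x c) := by
    intro c c' hc hc' hle
    obtain ⟨e, c'', rfl, hl⟩ := exists_mul_of_le_length hle
    obtain rfl : c'' = c := (hu c.length).unique ⟨hl, hc'.right⟩ ⟨rfl, hc⟩
    by_cases he : e = 1
    · exact ⟨1, by simp [he]⟩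
    · obtain ⟨g, hg⟩ := exists_mul_rmor x e he
      exact ⟨of x * g, by rw [map_mul, hg]; simp only [mul_assoc]⟩
  have huniq : ∀ q q', IsRightSpecial v q → IsRightSpecial v q' → q.length = q'.length →
      q = q' := by
    intro q q' hq hq' hl
    by_cases h1 : q = 1
    · rw [h1, FreeMonoid.length_one, eq_comm, FreeMonoid.length_eq_zero] at hl
      rw [h1, hl]
    have h1' : q' ≠ 1 := by
      rintro rfl
      exact h1 (FreeMonoid.length_eq_zero.1 hl)
    obtain ⟨c, r, hc, hr⟩ := h.exists_isRightSpecial hq h1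
    obtain ⟨c', r', hc', hr'⟩ := h.exists_isRightSpecial hq' h1'
    have hfin : ∀ {a b : FreeMonoid (Fin 2)}, a * q = b * q' → q = q' := fun {a b} hab => by
      have := congrArg FreeMonoid.length hab
      simp only [FreeMonoid.length_mul] at this
      exact ((mul_inj_of_length (by omega)).1 hab).2
    rcases le_total c.length c'.length with hle | hle
    · obtain ⟨g, hg⟩ := hsuff c c' hc hc' hle
      rw [hr, hr', ← mul_assoc] at hg
      exact hfin hg.symm
    · obtain ⟨g, hg⟩ := hsuff c' c hc' hc hle
      rw [hr, hr', ← mul_assoc] at hg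
      exact hfin hg
  intro n
  obtain ⟨p, ⟨rfl, hp⟩, -⟩ := hu n
  obtain ⟨q, r, hqr, hr⟩ := exists_mul_of_le_length ((nonerasing_rmor x).length_le p)
  have hrs := h.isRightSpecial_rmor hp
  rw [hqr] at hrs
  exact ⟨r, ⟨hr, hrs.right⟩, fun r' hr' => huniq _ _ hr'.2 hrs.right (hr'.1.trans hr.symm)⟩

end Sturmian

/-! ### The rewriting rules -/

section Rules

theorem end_mul_apply {M : Type*} [MulOneClass M] (f g : Monoid.End M) (m : M) :
    (f * g) m = f (g m) := rfl

theorem pow_hom_rgen {x y : Fin 2} (h : y ≠ x) (k : ℕ) :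
    ((rgen x).toEnd ^ k) (of x) = of x ∧ ((rgen x).toEnd ^ k) (of y) = of y * of x ^ k := by
  have h1 : (rgen x).toEnd = rmor x := hom_rgen x
  induction k with
  | zero => simp
  | succ k ih =>
    rw [pow_succ', end_mul_apply, end_mul_apply, ih.1, ih.2, h1]
    refine ⟨rmor_self x, ?_⟩
    change rmor x (of y * of x ^ k) = _
    rw [map_mul, map_pow, rmor_self, rmor_ne h, pow_succ', mul_assoc]

theorem pow_hom_lgen {x y : Fin 2} (h : y ≠ x) (k : ℕ) :
    ((lgen x).toEnd ^ k) (of x) = of x ∧ ((lgen x).toEnd ^ k) (of y) = of x ^ k * of y := by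
  have h1 : (lgen x).toEnd = lmor x := hom_lgen x
  induction k with
  | zero => simp
  | succ k ih =>
    rw [pow_succ', end_mul_apply, end_mul_apply, ih.1, ih.2, h1]
    refine ⟨lmor_self x, ?_⟩
    change lmor x (of x ^ k * of y) = _
    rw [map_mul, map_pow, lmor_self, lmor_ne h, pow_succ, mul_assoc]

theorem rgen_mul_pow_mul_lgen {x y : Fin 2} (h : y ≠ x) (k : ℕ) :
    (rgen y).toEnd * (rgen x).toEnd ^ k * (lgen y).toEnd =
      (lgen y).toEnd * (lgen x).toEnd ^ k * (rgen y).toEnd := by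
  have hr : (rgen y).toEnd = rmor y := hom_rgen y
  have hl : (lgen y).toEnd = lmor y := hom_lgen y
  apply FreeMonoid.hom_eq
  intro z
  change (rgen y).toEnd (((rgen x).toEnd ^ k) ((lgen y).toEnd (of z))) =
    (lgen y).toEnd (((lgen x).toEnd ^ k) ((rgen y).toEnd (of z)))
  by_cases hz : z = y
  · have h1 : (lgen y).toEnd (of y) = of y := by rw [hl]; exact lmor_self y
    have h2 : (rgen y).toEnd (of y) = of y := by rw [hr]; exact rmor_self y
    rw [hz, h1, h2, (pow_hom_rgen h k).2, (pow_hom_lgen h k).2, hr, hl]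
    change rmor y (of y * of x ^ k) = lmor y (of x ^ k * of y)
    rw [map_mul, map_mul, map_pow, map_pow, rmor_self, lmor_self, rmor_ne h.symm, lmor_ne h.symm,
      mul_pow_mul]
  · obtain rfl : z = x := eq_of_ne_of_ne h.symm hz
    have h1 : (lgen y).toEnd (of z) = of y * of z := by rw [hl]; exact lmor_ne hz
    have h2 : (rgen y).toEnd (of z) = of z * of y := by rw [hr]; exact rmor_ne hz
    rw [h1, h2, map_mul ((rgen z).toEnd ^ k), map_mul ((lgen z).toEnd ^ k), (pow_hom_rgen h k).1,
      (pow_hom_rgen h k).2, (pow_hom_lgen h k).1, (pow_hom_lgen h k).2, hr, hl]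
    change rmor y (of y * of z ^ k * of z) = lmor y (of z * (of z ^ k * of y))
    rw [mul_assoc, ← pow_succ, ← mul_assoc, ← pow_succ', map_mul, map_mul, map_pow, map_pow,
      rmor_self, lmor_self, rmor_ne hz, lmor_ne hz, mul_pow_mul]

theorem Rule.phi_eq {l r : List Gen} (h : Rule l r) : phi l = phi r := by
  cases h with
  | greek k => simpa [phi, mul_assoc, rgen, lgen] using
      rgen_mul_pow_mul_lgen (x := 0) (y := 1) (by decide) k
  | latin k => simpa [phi, mul_assoc, rgen, lgen] using
      rgen_mul_pow_mul_lgen (x := 1) (y := 0) (by decide) k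

theorem Rewrites.phi_eq {v w : List Gen} (h : Rewrites v w) : phi v = phi w := by
  induction h with
  | rel v w h =>
    obtain ⟨p, q, l, r, hlr, rfl, rfl⟩ := h
    have := hlr.phi_eq
    simp only [phi, List.map_append, List.prod_append] at this ⊢
    rw [this]
  | refl => rfl
  | symm _ _ _ ih => exact ih.symm
  | trans _ _ _ _ _ ih ih' => exact ih.trans ih'

end Rules

/-! ### Names without the letters `b` and `β` -/

section Names

/-- The morphism `φ_w` for `w ∈ {a, α}*`, where the letters of `w` are given by `rgen`. -/
def rphi : FreeMonoid (Fin 2) →* Monoid.End (FreeMonoid (Fin 2)) :=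
  FreeMonoid.lift fun a => (rgen a).toEnd

theorem rphi_eq (p : FreeMonoid (Fin 2)) : rphi p = phi (p.toList.map rgen) := by
  simp [rphi, phi, FreeMonoid.lift_apply, Function.comp_def]

theorem phiHom_rgen_of (l : List (Fin 2)) (z : Fin 2) :
    ∃ t, phiHom (l.map rgen) (of z) = of z * t := by
  induction l with
  | nil => exact ⟨1, rfl⟩
  | cons a l ih =>
    obtain ⟨t, ht⟩ := ih
    obtain ⟨t', ht'⟩ := exists_rmor_of a z
    exact ⟨t' * rmor a t, by
      rw [List.map_cons, phiHom_cons, MonoidHom.comp_apply, ht, hom_rgen, map_mul, ht', mul_assoc]⟩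

theorem phiHom_rgen_eq_self {l : List (Fin 2)} {z : Fin 2} (h : ∀ a ∈ l, a = z) :
    phiHom (l.map rgen) (of z) = of z := by
  induction l with
  | nil => rfl
  | cons a l ih =>
    rw [List.forall_mem_cons] at h
    rw [List.map_cons, phiHom_cons, MonoidHom.comp_apply, ih h.2, hom_rgen, h.1, rmor_self]

theorem isSturmianMorphism_rphi (p : FreeMonoid (Fin 2)) : IsSturmianMorphism (rphi p) := by
  rw [rphi_eq]
  intro u hu
  change ∃ v, IsImage (phiHom (p.toList.map rgen)) u v ∧ IsSturmian v
  induction p.toList with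
  | nil => exact ⟨u, isImage_one u, hu⟩
  | cons a l ih =>
    obtain ⟨v, hv, hvS⟩ := ih
    obtain ⟨v', hv'⟩ := (nonerasing_rmor a).exists_isImage v
    refine ⟨v', ?_, hv'.isSturmian_rmor hvS⟩
    rw [List.map_cons, phiHom_cons, hom_rgen]
    exact hv.comp hv'

theorem IsPrimitive.apply_of_ne {ψ : Monoid.End (FreeMonoid (Fin 2))} (h : IsPrimitive ψ)
    (z : Fin 2) : ψ (of z) ≠ of z := by
  intro hz
  obtain ⟨k, -, hk⟩ := h
  have hpow : ∀ k, (ψ ^ k) (of z) = of z := fun k => by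
    induction k with
    | zero => rfl
    | succ k ih => rw [pow_succ, end_mul_apply, hz, ih]
  have h0 := hk 0 z
  have h1 := hk 1 z
  rw [hpow, FreeMonoid.toList_of, List.mem_singleton] at h0 h1
  exact absurd (h0.trans h1.symm) (by decide)

/-- A morphism that at least doubles the length of each letter differs from its higher powers. -/
theorem pow_ne_self {ψ : Monoid.End (FreeMonoid (Fin 2))}
    (h : ∀ z, 1 < (ψ (of z)).length) {m : ℕ} (hm : 2 ≤ m) :
    ψ ^ m ≠ ψ := by
  have hn : Nonerasing ψ := fun z => Nat.zero_lt_one.trans (h z)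
  have hlt : ∀ p : FreeMonoid (Fin 2), p ≠ 1 → p.length < (ψ p).length := by
    intro p hp
    obtain ⟨z, q, rfl⟩ := exists_of_mul hp
    have h1 := h z
    have h2 : q.length ≤ (ψ q).length := hn.length_le q
    simp only [map_mul, FreeMonoid.length_mul, FreeMonoid.length_of]
    omega
  have hle : ∀ k p, p.length ≤ ((ψ ^ k) p).length := by
    intro k p
    induction k generalizing p with
    | zero => exact le_rfl
    | succ k ih => rw [pow_succ, end_mul_apply]; exact (hn.length_le p).trans (ih _)
  intro heq
  obtain ⟨k, rfl⟩ := Nat.exists_eq_add_of_le' hm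
  have h1 := hle k (ψ (ψ (of 0)))
  have h2 := hlt (ψ (of 0)) fun h' => by
    have := h 0
    rw [h'] at this
    simp at this
  have h3 : (ψ ^ (k + 2)) (of 0) = ψ (of 0) := by
    rw [heq]
  rw [pow_add, pow_two, end_mul_apply, end_mul_apply] at h3
  have h4 := congrArg FreeMonoid.length h3
  exact absurd (h1.trans_eq h4) (not_le.2 h2)

theorem factor_mul_of_periodic {A : Type*} {c : ℕ → A} {d : ℕ} (hd : ∀ i, c (i + d) = c i)
    (m : ℕ) : factor c 0 (m * d) = factor c 0 d ^ m := by
  have hmul : ∀ m i, c (i + m * d) = c i := fun m i =>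
    Function.Periodic.nat_mul (f := c) hd m i
  induction m with
  | zero => simp
  | succ m ih =>
    rw [Nat.succ_mul, factor_add, ih, pow_succ, zero_add]
    congr 1
    exact factor_inj.2 fun k _ => by rw [add_comm, hmul, zero_add]

/-- If two different shifts of a word with period `n` coincide, then the word has a smaller period
which divides `n`. -/
theorem exists_period_of_shift_eq {A : Type*} {c : ℕ → A} {n i j : ℕ} (hc : ∀ i, c (i + n) = c i)
    (hij : i < j) (hj : j < n) (h : ∀ m, c (i + m) = c (j + m)) :
    ∃ d m, 2 ≤ m ∧ n = m * d ∧ ∀ i, c (i + d) = c i := by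
  have hcm : ∀ m i, c (i + m * n) = c i := fun m i => Function.Periodic.nat_mul (f := c) hc m i
  have hr : ∀ m, c (m + (j - i)) = c m := fun m => by
    have h1 := h (m + i * (n - 1))
    obtain ⟨n, rfl⟩ : ∃ k, n = k + 1 := ⟨n - 1, by omega⟩
    rw [Nat.add_sub_cancel, show i + (m + i * n) = m + i * (n + 1) by ring,
      show j + (m + i * n) = (m + (j - i)) + i * (n + 1) by
        obtain ⟨t, rfl⟩ := Nat.exists_eq_add_of_le hij.le
        rw [Nat.add_sub_cancel_left]; ring, hcm, hcm] at h1
    exact h1.symm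
  have hrm : ∀ m i', c (i' + m * (j - i)) = c i' := fun m i' =>
    Function.Periodic.nat_mul (f := c) hr m i'
  have hdn := Nat.gcd_dvd_right (j - i) n
  have hdr := Nat.le_of_dvd (by omega) (Nat.gcd_dvd_left (j - i) n)
  obtain ⟨a, -, ha⟩ := Nat.exists_mul_mod_eq_gcd (n := j - i) (k := n) (by omega)
  set d := Nat.gcd (j - i) n
  obtain ⟨m, hm⟩ := hdn
  refine ⟨d, m, ?_, by rw [hm, mul_comm], fun i' => ?_⟩
  · by_contra! hlt
    interval_cases m <;> omega
  · have h1 := hrm a i'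
    rw [mul_comm a, ← Nat.mod_add_div ((j - i) * a) n, ha, ← add_assoc, mul_comm n, hcm] at h1
    exact h1

end Names

/-! ### The derivated words of the fixed points -/

section Main

theorem IsImage.apply_zero {A B : Type*} {ψ : FreeMonoid A →* FreeMonoid B} {u : ℕ → A}
    {v : ℕ → B} (h : IsImage ψ u v) {b : B} {t : FreeMonoid B} (ht : ψ (of (u 0)) = of b * t) :
    v 0 = b := by
  have h1 := h.factor_pos 0 1
  rw [factor_one, ht, FreeMonoid.length_mul, FreeMonoid.length_of, pos_zero, add_comm,
    factor_succ', mul_inj_of_length (by simp)] at h1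
  exact FreeMonoid.of_injective h1.1

/-- A fixed point of `φ_w` for `w ∈ {a, α}*` is the bottom of the tower that is obtained by removing
the letters of `w` periodically. -/
theorem exists_isTower {l : List (Fin 2)} (hl : ∀ a, a ∈ l) {u : ℕ → Fin 2}
    (hu : IsImage (phiHom (l.map rgen)) u u) :
    ∃ U, U 0 = u ∧ IsTower (u 0) (fun i => l.getD (i % l.length) 0) U ∧
      ∀ i, U (i + l.length) = U i := by
  have hn : 0 < l.length := List.length_pos_of_mem (hl 0)
  choose U hU using fun i : ℕ =>
    (nonerasing_phiHom ((l.drop (i % l.length)).map rgen)).exists_isImage u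
  have hU0 : ∀ i, i % l.length = 0 → U i = u := fun i hi => by
    have := hU i
    rw [hi] at this
    exact this.unique hu
  refine ⟨U, hU0 0 (Nat.zero_mod _), ⟨fun i => ?_, fun i => ?_, fun i a => ?_⟩, fun i => ?_⟩
  · obtain ⟨t, ht⟩ := phiHom_rgen_of (l.drop (i % l.length)) (u 0)
    exact (hU i).apply_zero ht
  · have hlt := Nat.mod_lt i hn
    have h1 : IsImage (phiHom ((l.drop (i % l.length + 1)).map rgen)) u (U (i + 1)) := by
      rcases (Nat.succ_le_of_lt hlt).lt_or_eq with h | h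
      · have := hU (i + 1)
        rwa [Nat.add_mod, Nat.mod_eq_of_lt (a := 1) (by omega), Nat.mod_eq_of_lt h] at this
      · have hmod : (i + 1) % l.length = 0 := by rw [← Nat.mod_add_mod, ← Nat.succ_eq_add_one, h,
          Nat.mod_self]
        rw [hU0 (i + 1) hmod, List.drop_of_length_le (by omega)]
        exact isImage_one u
    have h2 := hU i
    rw [List.drop_eq_getElem_cons hlt, List.map_cons, phiHom_cons, hom_rgen] at h2
    rw [← List.getD_eq_getElem _ 0 hlt] at h2
    exact h2.of_comp (nonerasing_rmor _) h1
  · obtain ⟨j, hj, rfl⟩ := List.getElem_of_mem (hl a)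
    refine ⟨j + (l.length - 1) * i, ?_⟩
    have : i + (j + (l.length - 1) * i) = j + l.length * i := by
      obtain ⟨k, hk⟩ : ∃ k, l.length = k + 1 := ⟨l.length - 1, by omega⟩
      rw [hk, Nat.add_sub_cancel]; ring
    rw [this, Nat.add_mul_mod_self_left, Nat.mod_eq_of_lt hj, List.getD_eq_getElem _ _ hj]
  · have h1 := hU (i + l.length)
    rw [Nat.add_mod_right] at h1
    exact h1.unique (hU i)

theorem count_factor {A : Type*} [DecidableEq A] (c : ℕ → A) (n : ℕ) (y : A) :
    (factor c 0 n).toList.count y = ((Finset.range n).filter fun i => c i = y).card := by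
  induction n with
  | zero => rfl
  | succ n ih =>
    rw [factor_succ, FreeMonoid.toList_mul, List.count_append, ih, Finset.range_add_one,
      Finset.filter_insert, zero_add, FreeMonoid.toList_of, List.count_singleton]
    by_cases h : c n = y <;> simp [h]

theorem factor_getD {A : Type*} (l : List A) (a : A) :
    factor (fun i => l.getD (i % l.length) a) 0 l.length = FreeMonoid.ofList l := by
  apply FreeMonoid.toList.injective
  apply List.ext_getElem
  · exact length_factor _ 0 _
  · intro i h1 h2
    have hi : i < l.length := h2
    rw [getElem_factor, zero_add, Nat.mod_eq_of_lt hi, List.getD_eq_getElem _ _ hi]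
    rfl

variable {l : List (Fin 2)}

theorem one_lt_length_of_isPrimitive (h : IsPrimitive (phi (l.map rgen))) (z : Fin 2) :
    1 < (phiHom (l.map rgen) (of z)).length := by
  obtain ⟨t, ht⟩ := phiHom_rgen_of l z
  have h1 : t ≠ 1 := by
    rintro rfl
    rw [mul_one] at ht
    exact h.apply_of_ne z ht
  have h2 : t.length ≠ 0 := fun h => h1 (FreeMonoid.length_eq_zero.1 h)
  rw [ht, FreeMonoid.length_mul, FreeMonoid.length_of]
  omega

theorem mem_of_isPrimitive (h : IsPrimitive (phi (l.map rgen))) (a : Fin 2) : a ∈ l := by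
  by_contra ha
  obtain ⟨y, hy⟩ : ∃ y : Fin 2, y ≠ a := (by decide : ∀ a : Fin 2, ∃ y, y ≠ a) a
  exact h.apply_of_ne y (phiHom_rgen_eq_self fun b hb =>
    eq_of_ne_of_ne hy fun hba => ha (hba ▸ hb))

/-- The number of derivated words of a fixed point, in terms of its first letter. -/
theorem encard_der_of_isFixedPoint (hprim : IsPrimitive (phi (l.map rgen)))
    (hpower : ∀ η : Monoid.End (FreeMonoid (Fin 2)), IsSturmianMorphism η →
      ∀ k : ℕ, η ^ k = phi (l.map rgen) → η = phi (l.map rgen))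
    {u : ℕ → Fin 2} (hu : IsFixedPoint (phi (l.map rgen)) u) {y : Fin 2} (hy : u 0 ≠ y) :
    (Der u).encard = 1 + (l.count y : ℕ∞) := by
  have hl := mem_of_isPrimitive hprim
  obtain ⟨U, rfl, hT, hU⟩ := exists_isTower hl hu
  have hlist := factor_getD l 0
  set c : ℕ → Fin 2 := fun i => l.getD (i % l.length) 0 with hcdef
  have hc : ∀ i, c (i + l.length) = c i := fun i => by simp [hcdef]
  -- a coincidence of two shifts of the periodic word `c` would make the morphism a proper power
  have hno : ∀ i j, i < j → j < l.length → ¬ ∀ m, c (i + m) = c (j + m) := by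
    intro i j hij hj h
    obtain ⟨d, m, hm, hn, hd⟩ := exists_period_of_shift_eq hc hij hj h
    have h1 : rphi (factor c 0 d) ^ m = phi (l.map rgen) := by
      rw [← map_pow, ← factor_mul_of_periodic hd, ← hn, hlist, rphi_eq, FreeMonoid.toList_ofList]
    have h2 := hpower _ (isSturmianMorphism_rphi _) m h1
    rw [h2] at h1
    exact pow_ne_self (one_lt_length_of_isPrimitive hprim) hm h1
  have hz : ∃ i < l.length, c i = U 0 0 := by
    obtain ⟨i, hi, h⟩ := List.getElem_of_mem (hl (U 0 0))
    exact ⟨i, hi, by rw [← h, hcdef, ← List.getD_eq_getElem _ 0 hi]; simp [Nat.mod_eq_of_lt hi]⟩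
  rw [hT.encard_der hy hc hU (fun i hi j hj h => ?_) hz, ← count_factor, hlist,
    FreeMonoid.toList_ofList]
  rcases lt_trichotomy i j with h1 | h1 | h1
  · exact absurd h (hno i j h1 hj)
  · exact h1
  · exact absurd (fun m => (h m).symm) (hno j i h1 hi)

theorem existsUnique_isFixedPoint (hprim : IsPrimitive (phi (l.map rgen))) (z : Fin 2) :
    ∃! u, IsFixedPoint (phi (l.map rgen)) u ∧ u 0 = z := by
  obtain ⟨t, ht⟩ := phiHom_rgen_of l z
  have hn := nonerasing_phiHom (l.map rgen)
  have ht1 : t ≠ 1 := by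
    rintro rfl
    rw [mul_one] at ht
    exact hprim.apply_of_ne z ht
  obtain ⟨u, hu, hu0⟩ := exists_isFixedPoint hn ht ht1
  exact ⟨u, ⟨hu, hu0⟩, fun v hv => isFixedPoint_unique hn (one_lt_length_of_isPrimitive hprim z)
    hv.1 hv.2 hu hu0⟩

theorem rgen_injective : Function.Injective rgen := by
  intro x y
  fin_cases x <;> fin_cases y <;> simp [rgen]

theorem exists_map_rgen {w : List Gen} (h : ∀ g ∈ w, g = Gen.a ∨ g = Gen.α) :
    ∃ l : List (Fin 2), w = l.map rgen := by
  induction w with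
  | nil => exact ⟨[], rfl⟩
  | cons g w ih =>
    rw [List.forall_mem_cons] at h
    obtain ⟨l, rfl⟩ := ih h.2
    rcases h.1 with rfl | rfl
    exacts [⟨0 :: l, rfl⟩, ⟨1 :: l, rfl⟩]

end Main

end Sturm

theorem proposition6p2 (ψ : Monoid.End (FreeMonoid (Fin 2))) (w : List Gen)
    (hname : IsNormalizedName ψ w)
    (hletters : ∀ g ∈ w, g = Gen.a ∨ g = Gen.α)
    (hfirst : w.head? = some Gen.a)
    (hprim : IsPrimitive ψ)
    (hpower : ∀ η : Monoid.End (FreeMonoid (Fin 2)), IsSturmianMorphism η →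
      ∀ k : ℕ, η ^ k = ψ → η = ψ) :
    ((∃! u : ℕ → Fin 2, IsFixedPoint ψ u ∧ u 0 = 0) ∧
      ∀ u : ℕ → Fin 2, IsFixedPoint ψ u → u 0 = 0 →
        (Der u).encard = 1 + (w.count Gen.α : ℕ∞)) ∧
    ((∃! u : ℕ → Fin 2, IsFixedPoint ψ u ∧ u 0 = 1) ∧
      ∀ u : ℕ → Fin 2, IsFixedPoint ψ u → u 0 = 1 →
        (Der u).encard = 1 + (w.count Gen.a : ℕ∞)) := by
  obtain ⟨w', rfl, hw, -⟩ := hname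
  rw [hw.phi_eq] at hprim hpower ⊢
  obtain ⟨l, rfl⟩ := exists_map_rgen hletters
  have hcount := fun y => List.count_map_of_injective l rgen rgen_injective y
  refine ⟨⟨existsUnique_isFixedPoint hprim 0, fun u hu hu0 => ?_⟩,
    existsUnique_isFixedPoint hprim 1, fun u hu hu0 => ?_⟩
  · rw [encard_der_of_isFixedPoint hprim hpower hu (y := 1) (by rw [hu0]; decide), ← hcount 1]
    rfl
  · rw [encard_der_of_isFixedPoint hprim hpower hu (y := 0) (by rw [hu0]; decide), ← hcount 0]
    rfl
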